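/- **Setting.** Fix a set $\mathcal A$ of external actions and $\tau\notin\mathcal A$; let $Act=\mathcal A\cup\{\tau\}$. The terms of finite state randomized CCS are $$T::=\mathbf 0\mid X\mid \sum_{i\in I}\alpha_i.T_i\mid\bigoplus_{i\in I}p_i\tau.T_i\mid\mu X.T,$$ with $I$ finite, non-empty in $\sum$ and $|I|\ge 2$ in $\bigoplus$, with $\alpha_i\in Act$, $p_i\in(0,1)$, $\sum_i p_i=1$; in $\mu X.T$ every free occurrence of $X$ in $T$ lies inside a $\sum$ or a $\bigoplus$. A process is a term without free variables; $\mathcal P$ is the set of processes. Transitions are generated by $\sum_i\alpha_i.T_i\xrightarrow{\alpha_i}T_i$, by $\bigoplus_i p_i\tau.T_i\xrightarrow{p_i\tau}T_i$, and by $\mu X.T\xrightarrow{\lambda}T'$ if $T\{\mu X.T/X\}\xrightarrow{\lambda}T'$. Collective silent transitions are generated by $\bigoplus_i p_i\tau.T_i\xrightarrow{\coprod_i p_i\tau}\coprod_i T_i$ and the same rule for $\mu$. $\mathsf{Reach}(A)$ is the set of processes reachable from $A$, and $A\Rightarrow B$ means that $B$ is reachable from $A$ by transitions labeled $\tau$ or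 $p\tau$. **Branching bisimulation.** Let $\mathcal E$ be an equivalence on $\mathcal P$. An $\epsilon$-tree of $A$ with regard to $\mathcal E$ is a tree with nodes labeled by elements of $[A]_{\mathcal E}$ and root labeled $A$, in which every node, labeled $B$ say, is a leaf, or has one child, labeled $B'$ with $B\xrightarrow{\tau}B'$, on an edge labeled $1$, or has $k\geq 2$ children, labeled $B_1,\dots,B_k$, on edges labeled $p_1,\dots,p_k$, with $B\xrightarrow{\coprod_i p_i\tau}\coprod_i B_i$. It is regular if $\lim_{k\to\infty}P_k=1$, where $P_k$ is the sum, over all leaves at depth at most $k$, of the products of the edge labels on the path from the root. For $\mathcal C\in\mathcal P/\mathcal E$: * if $\ell\in\mathcal A$, or $\ell=\tau$ and $\mathcal C\ne[A]_{\mathcal E}$, then $A\rightsquigarrow_{\mathcal E}\xrightarrow{\ell}\mathcal C$ means that there is a regular $\epsilon$-tree of $A$ for every leaf $L$ of which $L\xrightarrow{\ell}L'$ for some $L'\in\mathcal C$; * if $\mathcal C\ne[A]_{\mathcal E}$, then $A\rightsquigarrow_{\mathcal E}\xrightarrow{q}\mathcal C$ means that there is a regular $\epsilon$-tree of $A$ for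 every leaf $L$ of which there is some $L\xrightarrow{\coprod_i p_i\tau}\coprod_i L_i$ with $\sum_{L_i\in[L]_{\mathcal E}}p_i<1$ and $\big(\sum_{L_i\in\mathcal C}p_i\big)\big/\big(1-\sum_{L_i\in[L]_{\mathcal E}}p_i\big)=q$. $\mathcal E$ is a branching bisimulation if, whenever $(A,B)\in\mathcal E$, every such $\ell$- and $q$-transition from $A$ to a class $\mathcal C$ also exists from $B$ to $\mathcal C$. **$\tau$-ECs.** A $\tau$-EC of $A$ is a graph $\mathsf{ec}=(V,E)$ whose vertices are processes in $\mathsf{Reach}(A)$, with $V\neq\emptyset$, and whose labeled edges are transitions between vertices, such that any two (possibly equal) vertices are joined by a path with at least one edge; all edges are labeled $\tau$ or $p\tau$; and if an edge leaving $C$ is labeled $q\tau$, then it belongs to a collective silent transition $C\xrightarrow{\coprod_i p_i\tau}\coprod_i C_i$ all of whose transitions $C\xrightarrow{p_i\tau}C_i$ are edges of $\mathsf{ec}$. Write $A\Rightarrow\circlearrowleft_{\mathsf{ec}}$ if $A\Rightarrow A'$ for some $A'\in V$. For a relation $\mathcal R$, $\mathsf{ec}_1\,\mathcal R^{\ddagger}\,\mathsf{ec}_2$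 means that every vertex $Y$ of $\mathsf{ec}_2$ has some vertex $X$ of $\mathsf{ec}_1$ with $(X,Y)\in\mathcal R$. $\mathcal R$ is $\tau$-EC invariant if for all $(A,B)\in\mathcal R$: whenever $A\Rightarrow\circlearrowleft_{\mathsf{ec}_1}$ for a $\tau$-EC $\mathsf{ec}_1$, then $B\Rightarrow\circlearrowleft_{\mathsf{ec}_2}$ for some $\tau$-EC $\mathsf{ec}_2$ with $\mathsf{ec}_1\mathcal R^{\ddagger}\mathsf{ec}_2$; and whenever $B\Rightarrow\circlearrowleft_{\mathsf{ec}_2}$ for a $\tau$-EC $\mathsf{ec}_2$, then $A\Rightarrow\circlearrowleft_{\mathsf{ec}_1}$ for some $\tau$-EC $\mathsf{ec}_1$ with $\mathsf{ec}_2(\mathcal R^{-1})^{\ddagger}\mathsf{ec}_1$. Finally, $A\simeq_e B$ means that $(A,B)\in\mathcal E$ for some equivalence $\mathcal E$ on $\mathcal P$ that is a $\tau$-EC invariant branching bisimulation. **Procedure $\mathsf{CompMec}(P)$** (which computes a set of graphs, meant to be the maximal $\tau$-ECs that $P$ reaches silently). Start with no recorded graph and one undecided graph, the graph of all processes $X$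 with $P\Rightarrow X$ and all their transitions labeled $\tau$ or $p\tau$. In each round, decompose every undecided graph into its strongly connected components having at least one edge. Call an edge of a component bad if it is labeled $p\tau$ and its source has a transition labeled $q\tau$, for some $q$, that is not an edge of the component. Record every component without bad edges; delete all bad edges of every other component, which becomes an undecided graph of the next round. Stop when no undecided graph is left and return the set $\mathsf{MEC}_P$ of the recorded graphs. **Algorithm $\mathsf{ExhBranBisim}(A,B)$.** Let $R=\mathsf{Reach}(A)\cup\mathsf{Reach}(B)$ and $\mathcal E_{ini}=\{R\}$; partitions of $R$ are identified with equivalences on $R$, extended to $\mathcal P$ by the identity outside $R$. Repeat: 1. let $\mathcal E$ be the largest branching bisimulation contained in $\mathcal E_{ini}$; 2. search for a mec splitter, that is, a pair $(P,\mathsf{mec})$ with $\mathsf{mec}\in\mathsf{MEC}_P$ and $P\Rightarrow\circlearrowleft_{\mathsf{mec}}$ such that for some $Q$ with $(P,Q)\in\mathcal E$ there is no $\mathsf{mec}'\in\mathsf{MEC}_Q$ with $Q\Rightarrow\circlearrowleft_{\mathsf{mec}'}$ and $\mathsf{mec}\,\mathcal E^{\ddagger}\,\mathsf{mec}'$ ($P,Q\in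 R$); 3. if a mec splitter $(P,\mathsf{mec})$ is found (any one), let $\mathcal E_{ini}$ be obtained from $\mathcal E$ by splitting the class $[P]_{\mathcal E}$ into the set of those $Q$ for which there is $\mathsf{mec}'\in\mathsf{MEC}_Q$ with $Q\Rightarrow\circlearrowleft_{\mathsf{mec}'}$ and $\mathsf{mec}\,\mathcal E^{\ddagger}\,\mathsf{mec}'$, and the set of the other ones, and repeat; if there is no mec splitter, stop and return $\mathbf T$ if $(A,B)\in\mathcal E$ and $\mathbf F$ otherwise. **Theorem (Correctness).** For all processes $A,B\in\mathcal P$, every execution of $\mathsf{ExhBranBisim}(A,B)$ is well defined (all its subroutines terminate with a result, and the largest branching bisimulation in step 1 exists) and terminates, whichever splitters are chosen, and it returns $\mathbf T$ if and only if $A\simeq_e B$. -/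

import Mathlib

open Filter Topology

noncomputable section

namespace RCCS

universe u

/-! ### Syntax of finite state randomized CCS -/

/-- Actions: the external actions `a` in `𝒜`, and the internal action `τ`. -/
inductive Act (𝒜 : Type u) : Type u
  | tau : Act 𝒜
  | ext (a : 𝒜) : Act 𝒜

/-- Transition labels: an action, or `pτ` for a probability `p`. -/
inductive Label (𝒜 : Type u) : Type u
  | act (α : Act 𝒜) : Label 𝒜
  | prob (p : ℝ) : Label 𝒜

/-- Terms `T ::= 0 | X | ∑ αᵢ.Tᵢ | ⨁ pᵢτ.Tᵢ | μX.T`. Variables are natural numbers. The index set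
of `∑` has `n + 1 ≥ 1` elements, that of `⨁` has `n + 2 ≥ 2` elements. -/
inductive Term (𝒜 : Type u) : Type u
  | nil : Term 𝒜
  | var (x : ℕ) : Term 𝒜
  | sum (n : ℕ) (α : Fin (n + 1) → Act 𝒜) (T : Fin (n + 1) → Term 𝒜) : Term 𝒜
  | psum (n : ℕ) (p : Fin (n + 2) → ℝ) (hp : ∀ i, 0 < p i ∧ p i < 1) (hs : ∑ i, p i = 1)
      (T : Fin (n + 2) → Term 𝒜) : Term 𝒜
  | mu (x : ℕ) (T : Term 𝒜) : Term 𝒜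

namespace Term

variable {𝒜 : Type u}

/-- Free variables. -/
def freeVars : Term 𝒜 → Set ℕ
  | nil => ∅
  | var x => {x}
  | sum _ _ T => ⋃ i, (T i).freeVars
  | psum _ _ _ _ T => ⋃ i, (T i).freeVars
  | mu x T => T.freeVars \ {x}

/-- Every free occurrence of `x` lies inside a nondeterministic or probabilistic choice. -/
def GuardedIn (x : ℕ) : Term 𝒜 → Prop
  | nil => True
  | var y => y ≠ x
  | sum _ _ _ => True
  | psum _ _ _ _ _ => True
  | mu y T => y = x ∨ T.GuardedIn x

/-- In every subterm `μX.T` the variable `X` is guarded in `T`. -/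
def WellGuarded : Term 𝒜 → Prop
  | nil => True
  | var _ => True
  | sum _ _ T => ∀ i, (T i).WellGuarded
  | psum _ _ _ _ T => ∀ i, (T i).WellGuarded
  | mu x T => T.GuardedIn x ∧ T.WellGuarded

/-- `T.subst x S` is `T{S/X}`; it is only used with a closed `S`, so that no variable can be
captured. -/
def subst : Term 𝒜 → ℕ → Term 𝒜 → Term 𝒜
  | nil, _, _ => nil
  | var y, x, S => if y = x then S else var y
  | sum n α T, x, S => sum n α (fun i => (T i).subst x S)
  | psum n p hp hs T, x, S => psum n p hp hs (fun i => (T i).subst x S)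
  | mu y T, x, S => if y = x then mu y T else mu y (T.subst x S)

/-- The labeled transition system. -/
inductive Step : Term 𝒜 → Label 𝒜 → Term 𝒜 → Prop
  | sum (n : ℕ) (α : Fin (n + 1) → Act 𝒜) (T : Fin (n + 1) → Term 𝒜) (i : Fin (n + 1)) :
      Step (Term.sum n α T) (Label.act (α i)) (T i)
  | psum (n : ℕ) (p : Fin (n + 2) → ℝ) (hp : ∀ i, 0 < p i ∧ p i < 1) (hs : ∑ i, p i = 1)
      (T : Fin (n + 2) → Term 𝒜) (i : Fin (n + 2)) :
      Step (Term.psum n p hp hs T) (Label.prob (p i)) (T i)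
  | mu (x : ℕ) (T : Term 𝒜) (l : Label 𝒜) (T' : Term 𝒜) :
      Step (T.subst x (Term.mu x T)) l T' → Step (Term.mu x T) l T'

/-- Collective silent transitions: `Coll T k p S` is `T —∐ pᵢτ→ ∐ Sᵢ`, with `i` ranging over
`k` indices. -/
inductive Coll : Term 𝒜 → (k : ℕ) → (Fin k → ℝ) → (Fin k → Term 𝒜) → Prop
  | psum (n : ℕ) (p : Fin (n + 2) → ℝ) (hp : ∀ i, 0 < p i ∧ p i < 1) (hs : ∑ i, p i = 1)
      (T : Fin (n + 2) → Term 𝒜) :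
      Coll (Term.psum n p hp hs T) (n + 2) p T
  | mu (x : ℕ) (T : Term 𝒜) (k : ℕ) (p : Fin k → ℝ) (S : Fin k → Term 𝒜) :
      Coll (T.subst x (Term.mu x T)) k p S → Coll (Term.mu x T) k p S

end Term

/-- Processes: closed terms in which every bound variable is guarded. -/
def Proc (𝒜 : Type u) : Type u :=
  {T : Term 𝒜 // T.freeVars = ∅ ∧ T.WellGuarded}

variable {𝒜 : Type u}

/-- `P —l→ Q` for processes. -/
def Proc.Trans (P : Proc 𝒜) (l : Label 𝒜) (Q : Proc 𝒜) : Prop :=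
  Term.Step P.1 l Q.1

/-- `P —∐ pᵢτ→ ∐ Qᵢ` for processes. -/
def Proc.Coll (P : Proc 𝒜) (k : ℕ) (p : Fin k → ℝ) (Q : Fin k → Proc 𝒜) : Prop :=
  Term.Coll P.1 k p (fun i => (Q i).1)

/-- The set of processes reachable from `P` (by transitions with arbitrary labels). -/
def Reach (P : Proc 𝒜) : Set (Proc 𝒜) :=
  {Q | Relation.ReflTransGen (fun X Y : Proc 𝒜 => ∃ l, X.Trans l Y) P Q}

/-- The labels `τ` and `pτ`. -/
def Label.IsSilent : Label 𝒜 → Prop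
  | Label.act Act.tau => True
  | Label.act (Act.ext _) => False
  | Label.prob _ => True

/-- `P ⟹ Q`: `Q` is reached from `P` by finitely many transitions labeled `τ` or `pτ`. -/
def TauReach (P Q : Proc 𝒜) : Prop :=
  Relation.ReflTransGen (fun X Y : Proc 𝒜 => ∃ l, l.IsSilent ∧ X.Trans l Y) P Q

/-! ### `ε`-trees and branching bisimulations -/

/-- `ε`-trees of `A` with regard to `E`. A node is addressed by the list of child indices on the
way from the root to it, the last index first: the root is `[]`, and the `i`-th child of `u` is
`i :: u`. The label of the edge that enters a node `u ≠ []` is `wt u`. -/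
structure EpsTree (E : Setoid (Proc 𝒜)) (A : Proc 𝒜) where
  dom : Set (List ℕ)
  lab : List ℕ → Proc 𝒜
  wt : List ℕ → ℝ
  root_mem : [] ∈ dom
  parent_mem : ∀ (i : ℕ) (u : List ℕ), i :: u ∈ dom → u ∈ dom
  root_lab : lab [] = A
  lab_rel : ∀ u ∈ dom, E A (lab u)
  /-- A node is a leaf, or it has a single child reached by a transition `τ`, or its children are
  those of a collective silent transition. -/
  children : ∀ u ∈ dom,
    (∀ i, i :: u ∉ dom) ∨
    ((∀ i, i :: u ∈ dom ↔ i = 0) ∧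
      (lab u).Trans (Label.act Act.tau) (lab (0 :: u)) ∧ wt (0 :: u) = 1) ∨
    (∃ (k : ℕ) (p : Fin k → ℝ) (Q : Fin k → Proc 𝒜), (lab u).Coll k p Q ∧
      (∀ i, i :: u ∈ dom ↔ i < k) ∧
      (∀ i : Fin k, lab ((i : ℕ) :: u) = Q i ∧ wt ((i : ℕ) :: u) = p i))

namespace EpsTree

variable {E : Setoid (Proc 𝒜)} {A : Proc 𝒜}

/-- The leaves of the tree. -/
def leaves (t : EpsTree E A) : Set (List ℕ) :=
  {u | u ∈ t.dom ∧ ∀ i, i :: u ∉ t.dom}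

/-- The probability of the path from the root to a node. -/
def pathProb (t : EpsTree E A) : List ℕ → ℝ
  | [] => 1
  | i :: u => t.wt (i :: u) * t.pathProb u

/-- The total probability of the finite branches of length at most `k`. (A finite sum, as the tree
is finitely branching.) -/
def convUpTo (t : EpsTree E A) (k : ℕ) : ℝ :=
  ∑' u : {u : List ℕ // u ∈ t.leaves ∧ u.length ≤ k}, t.pathProb u.1

/-- The tree has convergence probability `1`. -/
def Regular (t : EpsTree E A) : Prop :=
  Tendsto t.convUpTo atTop (𝓝 1)

end EpsTree

/-- The `ℓ`-transition from `A` to the equivalence class `C` with regard to `E`. -/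
def LTrans (E : Setoid (Proc 𝒜)) (A : Proc 𝒜) (l : Act 𝒜) (C : Quotient E) : Prop :=
  ((∃ a, l = Act.ext a) ∨ (l = Act.tau ∧ C ≠ Quotient.mk E A)) ∧
  ∃ t : EpsTree E A, t.Regular ∧
    ∀ u ∈ t.leaves, ∃ L' : Proc 𝒜, (t.lab u).Trans (Label.act l) L' ∧ Quotient.mk E L' = C

open Classical in
/-- The probability that a collective silent transition with probabilities `p` and targets `Q`
arrives at the equivalence class `C`. -/
def arriveProb (E : Setoid (Proc 𝒜)) {k : ℕ} (p : Fin k → ℝ) (Q : Fin k → Proc 𝒜)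
    (C : Quotient E) : ℝ :=
  ∑ i, if Quotient.mk E (Q i) = C then p i else 0

/-- The `q`-transition from `A` to the equivalence class `C` with regard to `E`: at every leaf `L`
of some regular `ε`-tree, `L` has a collective silent transition that leaves its class with positive
probability and arrives at `C` with conditional probability `q` given that it leaves. -/
def QTrans (E : Setoid (Proc 𝒜)) (A : Proc 𝒜) (q : ℝ) (C : Quotient E) : Prop :=
  C ≠ Quotient.mk E A ∧
  ∃ t : EpsTree E A, t.Regular ∧
    ∀ u ∈ t.leaves, ∃ (k : ℕ) (p : Fin k → ℝ) (Q : Fin k → Proc 𝒜),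
      (t.lab u).Coll k p Q ∧
      arriveProb E p Q (Quotient.mk E (t.lab u)) < 1 ∧
      arriveProb E p Q C / (1 - arriveProb E p Q (Quotient.mk E (t.lab u))) = q

/-- Branching bisimulations. -/
def IsBranchingBisim (E : Setoid (Proc 𝒜)) : Prop :=
  ∀ A B : Proc 𝒜, E A B →
    (∀ (l : Act 𝒜) (C : Quotient E), LTrans E A l C → LTrans E B l C) ∧
    (∀ (q : ℝ) (C : Quotient E), QTrans E A q C → QTrans E B q C)

/-! ### `τ`-end components and exhaustive branching bisimilarity -/

/-- Graphs on processes with labeled edges. -/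
structure LGraph (𝒜 : Type u) where
  V : Set (Proc 𝒜)
  E : Set (Proc 𝒜 × Label 𝒜 × Proc 𝒜)

/-- There is an edge from `X` to `Y` in `g`. -/
def LGraph.Adj (g : LGraph 𝒜) (X Y : Proc 𝒜) : Prop :=
  ∃ l, (X, l, Y) ∈ g.E

/-- `ec` is a `τ`-end component of `B`. Strong connectivity is nontrivial: any two vertices, also
equal ones, are joined by a path with at least one edge, so that a single vertex without a silent
cycle is not a `τ`-end component. -/
structure IsTauEC (B : Proc 𝒜) (ec : LGraph 𝒜) : Prop where
  nonempty : ec.V.Nonempty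
  subset_reach : ec.V ⊆ Reach B
  edge : ∀ X l Y, (X, l, Y) ∈ ec.E → X ∈ ec.V ∧ Y ∈ ec.V ∧ X.Trans l Y
  connected : ∀ X ∈ ec.V, ∀ Y ∈ ec.V, Relation.TransGen ec.Adj X Y
  silent : ∀ X l Y, (X, l, Y) ∈ ec.E → l.IsSilent
  coll : ∀ X q Y, (X, Label.prob q, Y) ∈ ec.E →
    ∃ (k : ℕ) (p : Fin k → ℝ) (Q : Fin k → Proc 𝒜), X.Coll k p Q ∧
      (∃ i, p i = q ∧ Q i = Y) ∧ ∀ i, (X, Label.prob (p i), Q i) ∈ ec.E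

/-- `A` reaches a vertex of `ec` by silent transitions. -/
def ReachesEC (A : Proc 𝒜) (ec : LGraph 𝒜) : Prop :=
  ∃ A' ∈ ec.V, TauReach A A'

/-- `ec₁` is related to `ec₂` with regard to `r`. -/
def RelatedEC (r : Proc 𝒜 → Proc 𝒜 → Prop) (ec₁ ec₂ : LGraph 𝒜) : Prop :=
  ∀ Y ∈ ec₂.V, ∃ X ∈ ec₁.V, r X Y

/-- `τ`-EC invariant relations. (A `τ`-EC that `A` reaches silently is a `τ`-EC of `A`.) -/
def TauECInvariant (r : Proc 𝒜 → Proc 𝒜 → Prop) : Prop :=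
  ∀ A B : Proc 𝒜, r A B →
    (∀ ec₁, IsTauEC A ec₁ → ReachesEC A ec₁ →
      ∃ ec₂, IsTauEC B ec₂ ∧ ReachesEC B ec₂ ∧ RelatedEC r ec₁ ec₂) ∧
    (∀ ec₂, IsTauEC B ec₂ → ReachesEC B ec₂ →
      ∃ ec₁, IsTauEC A ec₁ ∧ ReachesEC A ec₁ ∧ RelatedEC (fun X Y => r Y X) ec₂ ec₁)

/-- Exhaustive branching bisimulations. -/
def IsExhaustiveBranchingBisim (E : Setoid (Proc 𝒜)) : Prop :=
  IsBranchingBisim E ∧ TauECInvariant (fun X Y => E X Y)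

/-- Exhaustive branching bisimilarity `A ≃ₑ B`. -/
def ExhBisimilar (A B : Proc 𝒜) : Prop :=
  ∃ E : Setoid (Proc 𝒜), IsExhaustiveBranchingBisim E ∧ E A B

/-! ### The procedure `CompMec` -/

/-- The induced `τ`-graph of `P`. -/
def tauGraph (P : Proc 𝒜) : LGraph 𝒜 where
  V := {X | TauReach P X}
  E := {e | TauReach P e.1 ∧ e.2.1.IsSilent ∧ e.1.Trans e.2.1 e.2.2}

/-- The strongly connected component of `X` in `g`, with all edges of `g` inside it. -/
def LGraph.sccOf (g : LGraph 𝒜) (X : Proc 𝒜) : LGraph 𝒜 where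
  V := {Y | Relation.TransGen g.Adj X Y ∧ Relation.TransGen g.Adj Y X}
  E := {e | e ∈ g.E ∧ (Relation.TransGen g.Adj X e.1 ∧ Relation.TransGen g.Adj e.1 X) ∧
    (Relation.TransGen g.Adj X e.2.2 ∧ Relation.TransGen g.Adj e.2.2 X)}

/-- The (nontrivial) strongly connected components of `g`. -/
def LGraph.sccs (g : LGraph 𝒜) : Set (LGraph 𝒜) :=
  {h | ∃ X ∈ g.V, Relation.TransGen g.Adj X X ∧ h = g.sccOf X}

/-- The edge `e` of `g` is labeled `pτ`, and its source has a transition labeled `qτ` that is not an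
edge of `g`. -/
def LGraph.BadEdge (g : LGraph 𝒜) (e : Proc 𝒜 × Label 𝒜 × Proc 𝒜) : Prop :=
  e ∈ g.E ∧ (∃ p, e.2.1 = Label.prob p) ∧
    ∃ (q : ℝ) (D : Proc 𝒜), e.1.Trans (Label.prob q) D ∧ (e.1, Label.prob q, D) ∉ g.E

/-- Remove all bad edges. -/
def LGraph.prune (g : LGraph 𝒜) : LGraph 𝒜 where
  V := g.V
  E := {e | e ∈ g.E ∧ ¬ g.BadEdge e}

/-- One round of the loop of `CompMec`. The state is the pair of the set of components found so far
and the set of undecided graphs. A strongly connected component of an undecided graph is recorded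
if it has no bad edge; otherwise it is pruned and becomes an undecided graph of the next round. -/
def compMecRound (s : Set (LGraph 𝒜) × Set (LGraph 𝒜)) : Set (LGraph 𝒜) × Set (LGraph 𝒜) :=
  (s.1 ∪ {h | ∃ g ∈ s.2, h ∈ g.sccs ∧ ∀ e, ¬ h.BadEdge e},
    {h' | ∃ g ∈ s.2, ∃ h ∈ g.sccs, (∃ e, h.BadEdge e) ∧ h' = h.prune})

/-- `CompMec(P)` terminates with the result `M`: the loop starts from the `τ`-graph of `P` and stops
when a round leaves no undecided graph. -/
def CompMec (P : Proc 𝒜) (M : Set (LGraph 𝒜)) : Prop :=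
  ∃ n : ℕ, (compMecRound^[n] (∅, {tauGraph P})).2 = ∅ ∧
    M = (compMecRound^[n] (∅, {tauGraph P})).1

/-! ### The algorithm `ExhBranBisim`

A partition of the finite set `R` of processes is represented by the equivalence relation on all
processes whose classes are the blocks of the partition and the singletons outside `R`. -/

/-- The set `R` of processes reachable from `A` or from `B`. -/
def reachSet (A B : Proc 𝒜) : Set (Proc 𝒜) :=
  Reach A ∪ Reach B

/-- The partition `{R}`. -/
def trivialPartition (R : Set (Proc 𝒜)) : Setoid (Proc 𝒜) where
  r X Y := X = Y ∨ (X ∈ R ∧ Y ∈ R)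
  iseqv :=
    { refl := fun _ => Or.inl rfl
      symm := by
        rintro X Y (h | h)
        · exact Or.inl h.symm
        · exact Or.inr h.symm
      trans := by
        rintro X Y Z (rfl | h) (rfl | h')
        · exact Or.inl rfl
        · exact Or.inr h'
        · exact Or.inr h
        · exact Or.inr ⟨h.1, h'.2⟩ }

/-- `E` is the result of `Quotient(Eini)`: the largest branching bisimulation contained in
`Eini`. -/
def IsQuotient (Eini E : Setoid (Proc 𝒜)) : Prop :=
  IsGreatest {F : Setoid (Proc 𝒜) | IsBranchingBisim F ∧ F ≤ Eini} E

/-- `Q` silently reaches some graph in `M` to which `mec` is related with regard to `E`. -/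
def ReachesRelated (E : Setoid (Proc 𝒜)) (mec : LGraph 𝒜) (M : Set (LGraph 𝒜)) (Q : Proc 𝒜) :
    Prop :=
  ∃ mec' ∈ M, ReachesEC Q mec' ∧ RelatedEC (fun X Y => E X Y) mec mec'

/-- `(P, mec)` is a mec splitter of `E`: `P` silently reaches `mec`, but some `Q` in the class of
`P` silently reaches no related component. (As `E` is symmetric, exchanging the roles of the two
processes of a pair gives no further splitters.) The argument `MEC` is the table of the results of
`CompMec`. -/
def IsMecSplitter (R : Set (Proc 𝒜)) (MEC : Proc 𝒜 → Set (LGraph 𝒜)) (E : Setoid (Proc 𝒜))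
    (P : Proc 𝒜) (mec : LGraph 𝒜) : Prop :=
  ∃ Q, P ∈ R ∧ Q ∈ R ∧ E P Q ∧ mec ∈ MEC P ∧ ReachesEC P mec ∧ ¬ ReachesRelated E mec (MEC Q) Q

/-- The possible results of `FindMecSplit(E)`: some mec splitter, or none if there is none. The
order in which the pairs of `E` are searched is left open. -/
inductive FindMecSplit (R : Set (Proc 𝒜)) (MEC : Proc 𝒜 → Set (LGraph 𝒜)) (E : Setoid (Proc 𝒜)) :
    Option (Proc 𝒜 × LGraph 𝒜) → Prop
  | notFound (h : ∀ P mec, ¬ IsMecSplitter R MEC E P mec) : FindMecSplit R MEC E none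
  | found (P : Proc 𝒜) (mec : LGraph 𝒜) (h : IsMecSplitter R MEC E P mec) :
      FindMecSplit R MEC E (some (P, mec))

/-- `MecRefine(E, (P, mec))`: the class of `P` is split into the processes that silently reach a
component to which `mec` is related and those that do not; the other classes are kept. -/
def mecRefine (MEC : Proc 𝒜 → Set (LGraph 𝒜)) (E : Setoid (Proc 𝒜)) (P : Proc 𝒜)
    (mec : LGraph 𝒜) : Setoid (Proc 𝒜) where
  r X Y := E X Y ∧ (E P X → (ReachesRelated E mec (MEC X) X ↔ ReachesRelated E mec (MEC Y) Y))
  iseqv :=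
    { refl := fun X => ⟨E.refl X, fun _ => Iff.rfl⟩
      symm := fun h => ⟨E.symm h.1, fun hp => (h.2 (E.trans hp (E.symm h.1))).symm⟩
      trans := fun h h' =>
        ⟨E.trans h.1 h'.1, fun hp => (h.2 hp).trans (h'.2 (E.trans hp h.1))⟩ }

/-- Configurations of `ExhBranBisim`: at the head of the loop with the current `Eini`, or halted
with the returned truth value. -/
inductive Config (𝒜 : Type u) : Type u
  | loop (Eini : Setoid (Proc 𝒜)) : Config 𝒜
  | halt (b : Bool) : Config 𝒜

/-- One iteration of the loop of `ExhBranBisim(A, B)`. -/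
inductive AlgStep (A B : Proc 𝒜) : Config 𝒜 → Config 𝒜 → Prop
  | refine (Eini E : Setoid (Proc 𝒜)) (MEC : Proc 𝒜 → Set (LGraph 𝒜)) (P : Proc 𝒜)
      (mec : LGraph 𝒜) (hE : IsQuotient Eini E)
      (hMEC : ∀ X ∈ reachSet A B, CompMec X (MEC X))
      (hfind : FindMecSplit (reachSet A B) MEC E (some (P, mec))) :
      AlgStep A B (Config.loop Eini) (Config.loop (mecRefine MEC E P mec))
  | finish (Eini E : Setoid (Proc 𝒜)) (MEC : Proc 𝒜 → Set (LGraph 𝒜)) (b : Bool)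
      (hE : IsQuotient Eini E)
      (hMEC : ∀ X ∈ reachSet A B, CompMec X (MEC X))
      (hfind : FindMecSplit (reachSet A B) MEC E none)
      (hb : b = true ↔ E A B) :
      AlgStep A B (Config.loop Eini) (Config.halt b)

/-- The initial configuration. -/
def initConfig (A B : Proc 𝒜) : Config 𝒜 :=
  Config.loop (trivialPartition (reachSet A B))

/-- Some execution of `ExhBranBisim(A, B)` returns `b`. -/
def Returns (A B : Proc 𝒜) (b : Bool) : Prop :=
  Relation.ReflTransGen (AlgStep A B) (initConfig A B) (Config.halt b)

/-- Every execution of `ExhBranBisim(A, B)` is finite. -/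
def Terminates (A B : Proc 𝒜) : Prop :=
  Acc (fun c' c => AlgStep A B c c') (initConfig A B)

/-- No execution of `ExhBranBisim(A, B)` gets stuck before it has returned a value; in particular,
all the calls to its subroutines have a result. -/
def NeverStuck (A B : Proc 𝒜) : Prop :=
  ∀ c, Relation.ReflTransGen (AlgStep A B) (initConfig A B) c →
    (∃ b, c = Config.halt b) ∨ ∃ c', AlgStep A B c c'

end RCCS

end

namespace RCCS

universe u

variable {𝒜 : Type u}

namespace Term

/-! ### Determinism of probabilistic choice -/

/-! A process has finitely many derivatives, so its silent behaviour is a finite Markov decision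
process. There, almost sure reachability is a graph property: a regular `ε`-tree of `A` with all
leaves in `S` exists iff `A` lies in a region `W` inside its class such that every state of `W` can
get to `S` by moves all of whose outcomes stay in `W` (`exists_regular_iff_conv`). After that,
probabilities enter only through conditional exit distributions, and each process has at most one
collective transition.

The central lemma is `IsBranchingBisim.le_stepSetoid`: processes related by a branching bisimulation
`F` have the same transitions to the classes of every `E` coarser than `F`. Hence suprema of
branching bisimulations are branching bisimulations, and the largest one below `Eini` exists.
Identifying the vertices of a `τ`-EC passes the same test
(`IsTauEC.trivialPartition_le_stepSetoid`), because its vertices reach each other almost surely; by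
maximality, step 1 never separates them.

The loop keeps three facts: every `τ`-EC lies in one class; the partition is the identity outside
`R`; and it contains the restriction to `R` of every exhaustive branching bisimulation. `CompMec`
yields `τ`-ECs, and every silently reached `τ`-EC is a subgraph of one of them. Since each `τ`-EC
lies in one class, testing the computed components is equivalent to testing all `τ`-ECs. So a split
loses no exhaustive bisimulation, and without a splitter the current partition is itself exhaustive.
Each split separates `P` from some `Q` in its class, which bounds the number of iterations. -/

theorem Coll.unique {T : Term 𝒜} {k : ℕ} {p : Fin k → ℝ} {S : Fin k → Term 𝒜}
    (h : Coll T k p S) {k' : ℕ} {p' : Fin k' → ℝ} {S' : Fin k' → Term 𝒜} (h' : Coll T k' p' S') :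
    (⟨k, p, S⟩ : Σ k : ℕ, (Fin k → ℝ) × (Fin k → Term 𝒜)) = ⟨k', p', S'⟩ := by
  induction h generalizing k' with
  | psum => cases h'; rfl
  | mu x T k p S _ ih => cases h' with | mu _ _ _ _ _ h' => exact ih h'

theorem Coll.not_act {T : Term 𝒜} {k : ℕ} {p : Fin k → ℝ} {S : Fin k → Term 𝒜}
    (h : Coll T k p S) (α : Act 𝒜) (T' : Term 𝒜) : ¬ Step T (Label.act α) T' := by
  induction h with
  | psum => intro h'; cases h'
  | mu x T k p S _ ih => intro h'; cases h' with | mu _ _ _ _ h' => exact ih h'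

theorem Coll.step {T : Term 𝒜} {k : ℕ} {p : Fin k → ℝ} {S : Fin k → Term 𝒜}
    (h : Coll T k p S) (i : Fin k) : Step T (Label.prob (p i)) (S i) := by
  induction h with
  | psum n p hp hs T => exact Step.psum n p hp hs T i
  | mu x T k p S _ ih => exact Step.mu _ _ _ _ (ih i)

theorem Step.exists_coll {T T' : Term 𝒜} {l : Label 𝒜} (h : Step T l T') :
    ∀ q, l = Label.prob q →
      ∃ (k : ℕ) (p : Fin k → ℝ) (S : Fin k → Term 𝒜), Coll T k p S ∧ ∃ i, p i = q ∧ S i = T' := by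
  induction h with
  | sum => intro q hq; cases hq
  | psum n p hp hs T i =>
    intro q hq
    cases hq
    exact ⟨_, p, T, Coll.psum n p hp hs T, i, rfl, rfl⟩
  | mu x T l T' _ ih =>
    intro q hq
    obtain ⟨k, p, S, hc, i, hi⟩ := ih q hq
    exact ⟨k, p, S, Coll.mu _ _ _ _ _ hc, i, hi⟩

theorem Coll.prob_spec {T : Term 𝒜} {k : ℕ} {p : Fin k → ℝ} {S : Fin k → Term 𝒜}
    (h : Coll T k p S) : (∀ i, 0 < p i ∧ p i < 1) ∧ ∑ i, p i = 1 := by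
  induction h with
  | psum n p hp hs T => exact ⟨hp, hs⟩
  | mu x T k p S _ ih => exact ih

/-- A term has finitely many transitions. -/
theorem finite_step (T : Term 𝒜) : {e : Label 𝒜 × Term 𝒜 | Step T e.1 e.2}.Finite := by
  by_cases hne : {e : Label 𝒜 × Term 𝒜 | Step T e.1 e.2}.Nonempty
  · obtain ⟨⟨l, T'⟩, h⟩ := hne
    change Step T l T' at h
    -- Unfolding a recursion need not shrink the term, so the induction runs over the derivation of
    -- one given transition.
    induction h with
    | sum n α T i =>
      refine (Set.finite_range fun i => (Label.act (α i), T i)).subset ?_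
      rintro ⟨l, S⟩ h
      cases h with | sum _ _ _ j => exact ⟨j, rfl⟩
    | psum n p hp hs T i =>
      refine (Set.finite_range fun i => ((Label.prob (p i) : Label 𝒜), T i)).subset ?_
      rintro ⟨l, S⟩ h
      cases h with | psum _ _ _ _ _ j => exact ⟨j, rfl⟩
    | mu x T l T' _ ih =>
      refine ih.subset ?_
      rintro ⟨l, S⟩ h
      cases h with | mu _ _ _ _ h => exact h
  · rw [Set.not_nonempty_iff_eq_empty.1 hne]
    exact Set.finite_empty

/-! ### Transitions preserve processes -/

theorem freeVars_subst {S : Term 𝒜} (hS : S.freeVars = ∅) (x : ℕ) (T : Term 𝒜) :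
    (T.subst x S).freeVars ⊆ T.freeVars \ {x} := by
  induction T with
  | nil => simp [subst, freeVars]
  | var y =>
    by_cases h : y = x
    · simp [subst, h, hS]
    · simp [subst, h, freeVars]
  | sum n α T ih =>
    simp only [subst, freeVars]
    intro z hz
    obtain ⟨i, hi⟩ := Set.mem_iUnion.1 hz
    exact ⟨Set.mem_iUnion.2 ⟨i, (ih i hi).1⟩, (ih i hi).2⟩
  | psum n p hp hs T ih =>
    simp only [subst, freeVars]
    intro z hz
    obtain ⟨i, hi⟩ := Set.mem_iUnion.1 hz
    exact ⟨Set.mem_iUnion.2 ⟨i, (ih i hi).1⟩, (ih i hi).2⟩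
  | mu y T ih =>
    by_cases h : y = x
    · subst h; simp [subst, freeVars]
    · simp only [subst, h, if_false, freeVars]
      intro z hz
      exact ⟨⟨(ih hz.1).1, hz.2⟩, (ih hz.1).2⟩

theorem guardedIn_of_notMem {x : ℕ} {T : Term 𝒜} (h : x ∉ T.freeVars) : T.GuardedIn x := by
  induction T with
  | nil => trivial
  | var y => intro e; exact h (by simp [freeVars, e])
  | sum n α T ih => trivial
  | psum n p hp hs T ih => trivial
  | mu y T ih =>
    by_cases e : y = x
    · exact Or.inl e
    · exact Or.inr (ih fun hx => h ⟨hx, fun e' => e e'.symm⟩)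

theorem GuardedIn.subst {S : Term 𝒜} (hS : S.freeVars = ∅) (x : ℕ) {y : ℕ} {T : Term 𝒜}
    (h : T.GuardedIn y) : (T.subst x S).GuardedIn y := by
  induction T with
  | nil => trivial
  | var z =>
    by_cases e : z = x
    · simp only [Term.subst, e, if_true]
      exact guardedIn_of_notMem (by simp [hS])
    · simpa only [Term.subst, e, if_false] using h
  | sum n α T ih => trivial
  | psum n p hp hs T ih => trivial
  | mu z T ih =>
    by_cases e : z = x
    · simpa only [Term.subst, e, if_true] using h
    · simp only [Term.subst, e, if_false]
      exact h.imp id ih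

theorem WellGuarded.subst {S : Term 𝒜} (hS : S.freeVars = ∅) (hS' : S.WellGuarded) (x : ℕ)
    {T : Term 𝒜} (h : T.WellGuarded) : (T.subst x S).WellGuarded := by
  induction T with
  | nil => trivial
  | var z =>
    by_cases e : z = x
    · simpa only [Term.subst, e, if_true] using hS'
    · simp only [Term.subst, e, if_false]; trivial
  | sum n α T ih => exact fun i => ih i (h i)
  | psum n p hp hs T ih => exact fun i => ih i (h i)
  | mu z T ih =>
    by_cases e : z = x
    · simpa only [Term.subst, e, if_true] using h
    · simp only [Term.subst, e, if_false]
      exact ⟨h.1.subst hS x, ih h.2⟩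

theorem closed_unfold {x : ℕ} {T : Term 𝒜}
    (h : (mu x T).freeVars = ∅ ∧ (mu x T).WellGuarded) :
    (T.subst x (mu x T)).freeVars = ∅ ∧ (T.subst x (mu x T)).WellGuarded :=
  ⟨Set.subset_empty_iff.1 ((freeVars_subst h.1 x T).trans h.1.subset), WellGuarded.subst h.1 h.2 x h.2.2⟩

theorem Step.closed {T T' : Term 𝒜} {l : Label 𝒜} (h : Step T l T')
    (hT : T.freeVars = ∅ ∧ T.WellGuarded) : T'.freeVars = ∅ ∧ T'.WellGuarded := by
  induction h with
  | sum n α T i => exact ⟨Set.iUnion_eq_empty.1 hT.1 i, hT.2 i⟩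
  | psum n p hp hs T i => exact ⟨Set.iUnion_eq_empty.1 hT.1 i, hT.2 i⟩
  | mu x T l T' _ ih => exact ih (closed_unfold hT)

/-! ### Finiteness of the set of derivatives -/

/-- Simultaneous substitution of (closed) terms for the free variables. -/
def msubst : Term 𝒜 → (ℕ → Term 𝒜) → Term 𝒜
  | nil, _ => nil
  | var y, σ => σ y
  | sum n α T, σ => sum n α fun i => (T i).msubst σ
  | psum n p hp hs T, σ => psum n p hp hs fun i => (T i).msubst σ
  | mu y T, σ => mu y (T.msubst (Function.update σ y (var y)))

theorem msubst_eq_self (T : Term 𝒜) (σ : ℕ → Term 𝒜) (h : ∀ x ∈ T.freeVars, σ x = var x) :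
    T.msubst σ = T := by
  induction T generalizing σ with
  | nil => rfl
  | var y => exact h y rfl
  | sum n α T ih =>
    simp only [msubst]
    congr 1; funext i
    exact ih i σ fun x hx => h x (Set.mem_iUnion.2 ⟨i, hx⟩)
  | psum n p hp hs T ih =>
    simp only [msubst]
    congr 1; funext i
    exact ih i σ fun x hx => h x (Set.mem_iUnion.2 ⟨i, hx⟩)
  | mu y T ih =>
    simp only [msubst]
    rw [ih]
    intro x hx
    by_cases e : x = y
    · subst e; simp
    · rw [Function.update_of_ne e]
      exact h x ⟨hx, e⟩

theorem exists_mem_freeVars_of_msubst {z : ℕ} (T : Term 𝒜) (σ : ℕ → Term 𝒜)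
    (h : z ∈ (T.msubst σ).freeVars) : ∃ x ∈ T.freeVars, z ∈ (σ x).freeVars := by
  induction T generalizing σ with
  | nil => exact absurd h (by simp [msubst, freeVars])
  | var y => exact ⟨y, rfl, h⟩
  | sum n α T ih =>
    obtain ⟨i, hi⟩ := Set.mem_iUnion.1 h
    obtain ⟨x, hx, hz⟩ := ih i σ hi
    exact ⟨x, Set.mem_iUnion.2 ⟨i, hx⟩, hz⟩
  | psum n p hp hs T ih =>
    obtain ⟨i, hi⟩ := Set.mem_iUnion.1 h
    obtain ⟨x, hx, hz⟩ := ih i σ hi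
    exact ⟨x, Set.mem_iUnion.2 ⟨i, hx⟩, hz⟩
  | mu y T ih =>
    obtain ⟨x, hx, hz⟩ := ih _ h.1
    by_cases e : x = y
    · subst e
      rw [Function.update_self] at hz
      exact absurd hz h.2
    · rw [Function.update_of_ne e] at hz
      exact ⟨x, ⟨hx, e⟩, hz⟩

theorem subst_eq_self {x : ℕ} {T S : Term 𝒜} (h : x ∉ T.freeVars) : T.subst x S = T := by
  induction T with
  | nil => rfl
  | var y =>
    have : y ≠ x := fun e => h (by simp [freeVars, e])
    simp [subst, this]
  | sum n α T ih =>
    simp only [subst]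
    congr 1; funext i
    exact ih i fun hx => h (Set.mem_iUnion.2 ⟨i, hx⟩)
  | psum n p hp hs T ih =>
    simp only [subst]
    congr 1; funext i
    exact ih i fun hx => h (Set.mem_iUnion.2 ⟨i, hx⟩)
  | mu y T ih =>
    by_cases e : y = x
    · simp [subst, e]
    · simp only [subst, e, if_false]
      rw [ih fun hx => h ⟨hx, fun e' => e e'.symm⟩]

/-- The hypothesis allows `σ y = var y` because this is what `msubst` leaves at a variable when it
passes under its binder; closedness of the other values excludes capture. -/
theorem subst_msubst (x : ℕ) (M T : Term 𝒜) (σ : ℕ → Term 𝒜)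
    (h : ∀ y, σ y = var y ∨ (σ y).freeVars = ∅) :
    (T.msubst σ).subst x M = T.msubst fun y => (σ y).subst x M := by
  induction T generalizing σ with
  | nil => rfl
  | var y => rfl
  | sum n α T ih =>
    simp only [msubst, subst]
    congr 1; funext i
    exact ih i σ h
  | psum n p hp hs T ih =>
    simp only [msubst, subst]
    congr 1; funext i
    exact ih i σ h
  | mu z T ih =>
    by_cases e : z = x
    · subst e
      simp only [msubst, subst, if_true]
      congr 2
      funext y
      by_cases e' : y = z
      · subst e'; simp
      · rw [Function.update_of_ne e', Function.update_of_ne e', subst_eq_self]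
        rcases h y with hy | hy
        · rw [hy]; exact fun h' => e' h'.symm
        · simp [hy]
    · simp only [msubst, subst, e, if_false]
      rw [ih]
      · congr 2
        funext y
        by_cases e' : y = z
        · subst e'; simp [subst, e]
        · rw [Function.update_of_ne e', Function.update_of_ne e']
      · intro y
        by_cases e' : y = z
        · subst e'; simp
        · rw [Function.update_of_ne e']; exact h y

/-- Unfolding an instance of `mu x T` gives an instance of the smaller term `T` under another closed
substitution. This lets structural induction control unfolding. -/
theorem unfold_msubst (x : ℕ) (T M : Term 𝒜) (σ : ℕ → Term 𝒜) (h : ∀ y, (σ y).freeVars = ∅) :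
    (T.msubst (Function.update σ x (var x))).subst x M = T.msubst (Function.update σ x M) := by
  rw [subst_msubst]
  · congr 1
    funext y
    by_cases e : y = x
    · subst e; simp [subst]
    · rw [Function.update_of_ne e, Function.update_of_ne e, subst_eq_self (by simp [h y])]
  · intro y
    by_cases e : y = x
    · subst e; simp
    · rw [Function.update_of_ne e]; exact Or.inr (h y)

/-- The terms that a transition derivation passes to: summands, and unfoldings of recursions. -/
def children : Term 𝒜 → Set (Term 𝒜)
  | nil => ∅
  | var _ => ∅
  | sum _ _ T => Set.range T
  | psum _ _ _ _ T => Set.range T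
  | mu x T => {T.subst x (mu x T)}

theorem Step.mem_of_children {T T' : Term 𝒜} {l : Label 𝒜} (h : Step T l T') {D : Set (Term 𝒜)}
    (hD : ∀ S ∈ D, S.children ⊆ D) (hT : T ∈ D) : T' ∈ D := by
  induction h with
  | sum n α T i => exact hD _ hT ⟨i, rfl⟩
  | psum n p hp hs T i => exact hD _ hT ⟨i, rfl⟩
  | mu x T l T' _ ih => exact ih (hD _ hT rfl)

theorem exists_finite_insert {n : ℕ} {U : Term 𝒜} {T : Fin (n + 1) → Term 𝒜} {D : Set (Term 𝒜)}
    (hU : U.children = Set.range T)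
    (h : ∀ i, ∃ D' : Set (Term 𝒜), D'.Finite ∧ D ⊆ D' ∧ T i ∈ D' ∧
      ∀ S ∈ D', S ∉ D → S.children ⊆ D') :
    ∃ D' : Set (Term 𝒜), D'.Finite ∧ D ⊆ D' ∧ U ∈ D' ∧ ∀ S ∈ D', S ∉ D → S.children ⊆ D' := by
  choose D' h1 h2 h3 h4 using h
  refine ⟨insert U (⋃ i, D' i), (Set.finite_iUnion h1).insert U,
    fun S hS => Or.inr (Set.mem_iUnion.2 ⟨0, h2 0 hS⟩), Or.inl rfl, ?_⟩
  rintro S (rfl | hS) hSD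
  · rw [hU]
    rintro _ ⟨i, rfl⟩
    exact Or.inr (Set.mem_iUnion.2 ⟨i, h3 i⟩)
  · obtain ⟨i, hi⟩ := Set.mem_iUnion.1 hS
    exact fun V hV => Or.inr (Set.mem_iUnion.2 ⟨i, h4 i S hi hSD hV⟩)

/-- Structural induction on `T` over all closed substitutions. `D` holds the values of `σ`, and
closure under `children` is demanded only for what is added to `D`, since the members of `D` are
handled where they were introduced. At `mu x T` the instance `M` itself joins `D` before the
induction proceeds to the body with `x` sent to `M`. -/
theorem exists_finite_derivatives (T : Term 𝒜) (σ : ℕ → Term 𝒜) (hσ : ∀ x, (σ x).freeVars = ∅)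
    (D : Set (Term 𝒜)) (hD : D.Finite) (hσD : ∀ x, σ x ∈ D) :
    ∃ D' : Set (Term 𝒜), D'.Finite ∧ D ⊆ D' ∧ T.msubst σ ∈ D' ∧
      ∀ S ∈ D', S ∉ D → S.children ⊆ D' := by
  induction T generalizing σ D with
  | nil =>
    refine ⟨insert nil D, hD.insert _, Set.subset_insert _ _, Or.inl rfl, ?_⟩
    rintro S (rfl | hS) hSD
    · exact Set.empty_subset _
    · exact absurd hS hSD
  | var y => exact ⟨D, hD, subset_rfl, hσD y, fun S hS hS' => absurd hS hS'⟩
  | sum n α T ih =>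
    exact exists_finite_insert (T := fun i => (T i).msubst σ) rfl fun i => ih i σ hσ D hD hσD
  | psum n p hp hs T ih =>
    exact exists_finite_insert (T := fun i => (T i).msubst σ) rfl fun i => ih i σ hσ D hD hσD
  | mu x T ih =>
    have hM : ((mu x T).msubst σ).freeVars = ∅ := by
      refine Set.eq_empty_iff_forall_notMem.2 fun z hz => ?_
      obtain ⟨y, _, hy⟩ := exists_mem_freeVars_of_msubst _ σ hz
      simp [hσ y] at hy
    set M := (mu x T).msubst σ with hMdef
    obtain ⟨D', h1, h2, h3, h4⟩ := ih (Function.update σ x M)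
      (fun y => by
        by_cases e : y = x
        · subst e; simpa using hM
        · rw [Function.update_of_ne e]; exact hσ y)
      (insert M D) (hD.insert M)
      (fun y => by
        by_cases e : y = x
        · subst e; simp
        · rw [Function.update_of_ne e]; exact Or.inr (hσD y))
    refine ⟨D', h1, fun S hS => h2 (Or.inr hS), h2 (Or.inl rfl), fun S hS hSD => ?_⟩
    -- The induction hypothesis says nothing about the children of `M`, which it counts as given;
    -- the only one is the unfolding, which is the instance of the body.
    by_cases e : S = M
    · subst e
      rintro _ rfl
      change (T.msubst (Function.update σ x (var x))).subst x M ∈ D'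
      rw [unfold_msubst x T M σ hσ]
      exact h3
    · exact h4 S hS fun h => h.elim e hSD

end Term

/-! ### Transitions of processes -/

theorem Reach.refl (P : Proc 𝒜) : P ∈ Reach P := Relation.ReflTransGen.refl

theorem Reach.trans {P Q S : Proc 𝒜} (h : Q ∈ Reach P) (h' : S ∈ Reach Q) : S ∈ Reach P :=
  Relation.ReflTransGen.trans h h'

theorem Reach.tail {P Q S : Proc 𝒜} {l : Label 𝒜} (h : Q ∈ Reach P) (h' : Q.Trans l S) :
    S ∈ Reach P :=
  Relation.ReflTransGen.tail h ⟨l, h'⟩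

theorem TauReach.reach {P Q : Proc 𝒜} (h : TauReach P Q) : Q ∈ Reach P :=
  Relation.ReflTransGen.mono (fun _ _ h => ⟨h.choose, h.choose_spec.2⟩) _ _ h

theorem finite_reach (P : Proc 𝒜) : (Reach P).Finite := by
  -- On a closed term the substitution acts trivially; the value `nil` is chosen because it has no
  -- children, which makes all of `D` closed.
  obtain ⟨D, hD, _, hP, hc⟩ := Term.exists_finite_derivatives P.1 (fun _ => Term.nil)
    (fun _ => rfl) {Term.nil} (Set.finite_singleton _) (fun _ => rfl)
  rw [Term.msubst_eq_self _ _ (by simp [P.2.1])] at hP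
  have hc' : ∀ S ∈ D, S.children ⊆ D := by
    intro S hS
    by_cases h : S = Term.nil
    · subst h; exact Set.empty_subset _
    · exact hc S hS h
  refine (hD.preimage (f := Subtype.val) Subtype.val_injective.injOn).subset fun Q hQ => ?_
  change Q.1 ∈ D
  induction hQ with
  | refl => exact hP
  | tail _ h ih => exact h.choose_spec.mem_of_children hc' ih

theorem Proc.finite_trans (X : Proc 𝒜) : {e : Label 𝒜 × Proc 𝒜 | X.Trans e.1 e.2}.Finite := by
  refine ((Term.finite_step X.1).preimage
    (f := fun e : Label 𝒜 × Proc 𝒜 => (e.1, e.2.1)) ?_).subset fun e he => he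
  rintro ⟨l, Y⟩ _ ⟨l', Y'⟩ _ h
  simp only [Prod.mk.injEq] at h
  exact Prod.ext h.1 (Subtype.ext h.2)

namespace Proc.Coll

variable {X : Proc 𝒜} {k : ℕ} {p : Fin k → ℝ} {Q : Fin k → Proc 𝒜}

theorem unique (h : X.Coll k p Q) {k' : ℕ} {p' : Fin k' → ℝ} {Q' : Fin k' → Proc 𝒜}
    (h' : X.Coll k' p' Q') :
    (⟨k, p, Q⟩ : Σ k : ℕ, (Fin k → ℝ) × (Fin k → Proc 𝒜)) = ⟨k', p', Q'⟩ := by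
  have := Term.Coll.unique h h'
  obtain rfl : k = k' := congrArg Sigma.fst this
  simp only [Sigma.mk.injEq, heq_eq_eq, Prod.mk.injEq, true_and] at this
  obtain ⟨rfl, hS⟩ := this
  have : Q = Q' := funext fun i => Subtype.ext (congrFun hS i)
  rw [this]

theorem not_act (h : X.Coll k p Q) (α : Act 𝒜) (Y : Proc 𝒜) : ¬ X.Trans (Label.act α) Y :=
  Term.Coll.not_act h α Y.1

theorem trans (h : X.Coll k p Q) (i : Fin k) : X.Trans (Label.prob (p i)) (Q i) :=
  Term.Coll.step h i

theorem pos (h : X.Coll k p Q) (i : Fin k) : 0 < p i := (Term.Coll.prob_spec h).1 i |>.1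

theorem sum_eq (h : X.Coll k p Q) : ∑ i, p i = 1 := (Term.Coll.prob_spec h).2

end Proc.Coll

theorem Proc.Trans.exists_coll {X Y : Proc 𝒜} {q : ℝ} (h : X.Trans (Label.prob q) Y) :
    ∃ (k : ℕ) (p : Fin k → ℝ) (Q : Fin k → Proc 𝒜), X.Coll k p Q ∧ ∃ i, p i = q ∧ Q i = Y := by
  obtain ⟨k, p, S, hc, i, hi, hS⟩ := Term.Step.exists_coll h q rfl
  exact ⟨k, p, fun j => ⟨S j, (hc.step j).closed X.2⟩, hc, i, hi, Subtype.ext hS⟩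

/-! ### Almost sure reachability -/

/-- A silent transition from `X` that may arrive at `Y` and certainly arrives in `W`. -/
def SafeStep (W : Set (Proc 𝒜)) (X Y : Proc 𝒜) : Prop :=
  (X.Trans (Label.act Act.tau) Y ∧ Y ∈ W) ∨
    ∃ (k : ℕ) (p : Fin k → ℝ) (Q : Fin k → Proc 𝒜), X.Coll k p Q ∧ (∀ i, Q i ∈ W) ∧ ∃ i, Q i = Y

/-- Within the class of `A`, and in a region that is never left, every state can get to `S`. For
processes this means that some strategy reaches `S` with probability one. -/
def Conv (E : Setoid (Proc 𝒜)) (A : Proc 𝒜) (S : Set (Proc 𝒜)) : Prop :=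
  ∃ W : Set (Proc 𝒜), A ∈ W ∧ (∀ X ∈ W, E A X) ∧
    ∀ X ∈ W, ∃ L ∈ S, Relation.ReflTransGen (SafeStep W) X L

theorem SafeStep.mem {W : Set (Proc 𝒜)} {X Y : Proc 𝒜} (h : SafeStep W X Y) : Y ∈ W := by
  rcases h with h | ⟨k, p, Q, _, hW, i, rfl⟩
  · exact h.2
  · exact hW i

theorem SafeStep.exists_trans {W : Set (Proc 𝒜)} {X Y : Proc 𝒜} (h : SafeStep W X Y) :
    ∃ l : Label 𝒜, l.IsSilent ∧ X.Trans l Y := by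
  rcases h with h | ⟨k, p, Q, hc, _, i, rfl⟩
  · exact ⟨Label.act Act.tau, trivial, h.1⟩
  · exact ⟨Label.prob (p i), trivial, hc.trans i⟩

theorem SafeStep.mono {W W' : Set (Proc 𝒜)} (h : W ⊆ W') {X Y : Proc 𝒜} (hs : SafeStep W X Y) :
    SafeStep W' X Y := by
  rcases hs with hs | ⟨k, p, Q, hc, hW, hi⟩
  · exact Or.inl ⟨hs.1, h hs.2⟩
  · exact Or.inr ⟨k, p, Q, hc, fun i => h (hW i), hi⟩

theorem mem_of_reflTransGen_safeStep {W : Set (Proc 𝒜)} {X Y : Proc 𝒜} (hX : X ∈ W)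
    (h : Relation.ReflTransGen (SafeStep W) X Y) : Y ∈ W := by
  induction h with
  | refl => exact hX
  | tail _ h _ => exact h.mem

/-- Restriction of a safe path to a set that is closed under transitions. -/
theorem reflTransGen_safeStep_inter {W R : Set (Proc 𝒜)}
    (hR : ∀ X ∈ R, ∀ l Y, X.Trans l Y → Y ∈ R) {X Y : Proc 𝒜} (hX : X ∈ R)
    (h : Relation.ReflTransGen (SafeStep W) X Y) :
    Y ∈ R ∧ Relation.ReflTransGen (SafeStep (W ∩ R)) X Y := by
  induction h with
  | refl => exact ⟨hX, Relation.ReflTransGen.refl⟩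
  | tail _ h ih =>
    refine ⟨?_, ih.2.tail ?_⟩
    · obtain ⟨l, _, hl⟩ := h.exists_trans
      exact hR _ ih.1 _ _ hl
    · rcases h with h | ⟨k, p, Q, hc, hW, hi⟩
      · exact Or.inl ⟨h.1, h.2, hR _ ih.1 _ _ h.1⟩
      · exact Or.inr ⟨k, p, Q, hc, fun i => ⟨hW i, hR _ ih.1 _ _ (hc.trans i)⟩, hi⟩

/-- With `R` the set of derivatives of `A`, this makes the region finite, so that ranks and
probabilities are uniformly bounded on it. -/
theorem Conv.restrict {E : Setoid (Proc 𝒜)} {A : Proc 𝒜} {S R : Set (Proc 𝒜)}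
    (hR : ∀ X ∈ R, ∀ l Y, X.Trans l Y → Y ∈ R) (hA : A ∈ R) (h : Conv E A S) :
    ∃ W ⊆ R, A ∈ W ∧ (∀ X ∈ W, E A X) ∧
      ∀ X ∈ W, ∃ L ∈ S, Relation.ReflTransGen (SafeStep W) X L := by
  obtain ⟨W, hAW, hWE, hW⟩ := h
  refine ⟨W ∩ R, Set.inter_subset_right, ⟨hAW, hA⟩, fun X hX => hWE X hX.1, fun X hX => ?_⟩
  obtain ⟨L, hL, hXL⟩ := hW X hX.1
  exact ⟨L, hL, (reflTransGen_safeStep_inter hR hX.2 hXL).2⟩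

/-! ### Mass of the levels of an `ε`-tree, and regularity -/

namespace EpsTree

variable {E : Setoid (Proc 𝒜)} {A : Proc 𝒜} (t : EpsTree E A)

theorem exists_deg {u : List ℕ} (hu : u ∈ t.dom) :
    ∃ k : ℕ, (∀ i, i :: u ∈ t.dom ↔ i < k) ∧ (k ≠ 0 → ∑ i ∈ Finset.range k, t.wt (i :: u) = 1) ∧
      ∀ i < k, 0 < t.wt (i :: u) := by
  rcases t.children u hu with h | ⟨h, _, hw⟩ | ⟨k, p, Q, hc, h, hi⟩
  · exact ⟨0, by simpa using h, by simp, by simp⟩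
  · refine ⟨1, fun i => (h i).trans Nat.lt_one_iff.symm, fun _ => by simpa using hw, ?_⟩
    intro i hi
    obtain rfl := Nat.lt_one_iff.1 hi
    simp [hw]
  · refine ⟨k, h, fun _ => ?_, fun i hik => ?_⟩
    · rw [Finset.sum_range fun i => t.wt (i :: u), ← hc.sum_eq]
      exact Finset.sum_congr rfl fun i _ => (hi i).2
    · rw [(hi ⟨i, hik⟩).2]
      exact hc.pos _

open Classical in
/-- The number of children of a node. -/
noncomputable def deg (u : List ℕ) : ℕ :=
  if h : u ∈ t.dom then (t.exists_deg h).choose else 0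

theorem mem_dom_iff_lt_deg {u : List ℕ} (hu : u ∈ t.dom) (i : ℕ) :
    i :: u ∈ t.dom ↔ i < t.deg u := by
  rw [deg, dif_pos hu]
  exact (t.exists_deg hu).choose_spec.1 i

theorem sum_wt {u : List ℕ} (hu : u ∈ t.dom) (h : u ∉ t.leaves) :
    ∑ i ∈ Finset.range (t.deg u), t.wt (i :: u) = 1 := by
  have h0 : t.deg u ≠ 0 := fun h0 => h ⟨hu, fun i => by simp [t.mem_dom_iff_lt_deg hu, h0]⟩
  rw [deg, dif_pos hu] at h0 ⊢
  exact (t.exists_deg hu).choose_spec.2.1 h0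

theorem wt_pos {u : List ℕ} {i : ℕ} (h : i :: u ∈ t.dom) : 0 < t.wt (i :: u) := by
  have hu := t.parent_mem i u h
  exact (t.exists_deg hu).choose_spec.2.2 i (((t.exists_deg hu).choose_spec.1 i).1 h)

theorem deg_eq_zero {u : List ℕ} (h : u ∈ t.leaves) : t.deg u = 0 := by
  by_contra h0
  exact h.2 0 ((t.mem_dom_iff_lt_deg h.1 0).2 (Nat.pos_of_ne_zero h0))

theorem pathProb_pos {u : List ℕ} (h : u ∈ t.dom) : 0 < t.pathProb u := by
  induction u with
  | nil => exact one_pos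
  | cons i u ih => exact mul_pos (t.wt_pos h) (ih (t.parent_mem i u h))

/-- The children of the nodes in a finite set. -/
noncomputable def next (F : Finset (List ℕ)) : Finset (List ℕ) :=
  F.biUnion fun u => (Finset.range (t.deg u)).image (· :: u)

theorem mem_next {F : Finset (List ℕ)} (hF : ∀ u ∈ F, u ∈ t.dom) {v : List ℕ} :
    v ∈ t.next F ↔ v ∈ t.dom ∧ ∃ u ∈ F, ∃ i, v = i :: u := by
  simp only [next, Finset.mem_biUnion, Finset.mem_image, Finset.mem_range]
  constructor
  · rintro ⟨u, hu, i, hi, rfl⟩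
    exact ⟨(t.mem_dom_iff_lt_deg (hF u hu) i).2 hi, u, hu, i, rfl⟩
  · rintro ⟨hv, u, hu, i, rfl⟩
    exact ⟨u, hu, i, (t.mem_dom_iff_lt_deg (hF u hu) i).1 hv, rfl⟩

theorem sum_next (F : Finset (List ℕ)) (f : List ℕ → ℝ) :
    ∑ v ∈ t.next F, f v = ∑ u ∈ F, ∑ i ∈ Finset.range (t.deg u), f (i :: u) := by
  rw [next, Finset.sum_biUnion]
  · refine Finset.sum_congr rfl fun u _ => Finset.sum_image fun i _ j _ h => ?_
    simpa using h
  · intro u _ v _ huv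
    refine Finset.disjoint_left.2 fun w hw hw' => huv ?_
    obtain ⟨i, _, rfl⟩ := Finset.mem_image.1 hw
    obtain ⟨j, _, h⟩ := Finset.mem_image.1 hw'
    simp only [List.cons.injEq] at h
    exact h.2.symm

/-- The nodes at a given depth. -/
noncomputable def level : ℕ → Finset (List ℕ)
  | 0 => {[]}
  | k + 1 => t.next (level k)

theorem mem_level {k : ℕ} {u : List ℕ} : u ∈ t.level k ↔ u ∈ t.dom ∧ u.length = k := by
  induction k generalizing u with
  | zero =>
    simp only [level, Finset.mem_singleton, List.length_eq_zero_iff]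
    exact ⟨fun h => ⟨h ▸ t.root_mem, h⟩, fun h => h.2⟩
  | succ k ih =>
    rw [level, t.mem_next fun u hu => (ih.1 hu).1]
    constructor
    · rintro ⟨hv, u, hu, i, rfl⟩
      exact ⟨hv, by simp [(ih.1 hu).2]⟩
    · rintro ⟨hv, hl⟩
      cases u with
      | nil => simp at hl
      | cons i u => exact ⟨hv, u, ih.2 ⟨t.parent_mem i u hv, by simpa using hl⟩, i, rfl⟩

open Classical in
/-- The probability that a branch has not converged within depth `k`. -/
noncomputable def openMass (k : ℕ) : ℝ :=
  ∑ u ∈ t.level k with u ∉ t.leaves, t.pathProb u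

open Classical in
theorem convUpTo_eq (k : ℕ) :
    t.convUpTo k = ∑ j ∈ Finset.range (k + 1), ∑ u ∈ t.level j with u ∈ t.leaves, t.pathProb u := by
  rw [← Finset.sum_biUnion]
  · rw [convUpTo]
    have : {u : List ℕ | u ∈ t.leaves ∧ u.length ≤ k} =
        ↑((Finset.range (k + 1)).biUnion fun j => {u ∈ t.level j | u ∈ t.leaves}) := by
      ext u
      simp only [Set.mem_ofPred_eq, Finset.coe_biUnion, Set.mem_iUnion, Finset.mem_coe,
        Finset.mem_filter, Finset.mem_range, t.mem_level]
      constructor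
      · rintro ⟨h, hk⟩
        exact ⟨u.length, by omega, ⟨h.1, rfl⟩, h⟩
      · rintro ⟨j, hj, ⟨_, rfl⟩, h⟩
        exact ⟨h, by omega⟩
    change ∑' u : ({u : List ℕ | u ∈ t.leaves ∧ u.length ≤ k} : Set (List ℕ)), t.pathProb u.1 = _
    rw [this]
    exact Finset.tsum_subtype' _ t.pathProb
  · intro i _ j _ hij
    refine Finset.disjoint_left.2 fun u hu hu' => hij ?_
    rw [← (t.mem_level.1 (Finset.mem_filter.1 hu).1).2, ← (t.mem_level.1 (Finset.mem_filter.1 hu').1).2]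

theorem sum_pathProb_children {u : List ℕ} (hu : u ∈ t.dom) (h : u ∉ t.leaves) :
    ∑ i ∈ Finset.range (t.deg u), t.pathProb (i :: u) = t.pathProb u := by
  simp only [pathProb]
  rw [← Finset.sum_mul, t.sum_wt hu h, one_mul]

open Classical in
theorem sum_level_succ (k : ℕ) (f : List ℕ → ℝ) :
    ∑ v ∈ t.level (k + 1), f v =
      ∑ u ∈ t.level k with u ∉ t.leaves, ∑ i ∈ Finset.range (t.deg u), f (i :: u) := by
  rw [level, sum_next, Finset.sum_filter]
  refine Finset.sum_congr rfl fun u _ => ?_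
  split_ifs with h
  · rw [t.deg_eq_zero h]; simp
  · rfl

/-- Conservation of mass: an inner node hands its whole path probability to its children, and a leaf
keeps it for good. -/
theorem convUpTo_add_openMass (k : ℕ) : t.convUpTo k + t.openMass k = 1 := by
  classical
  rw [convUpTo_eq, openMass]
  induction k with
  | zero =>
    rw [Finset.sum_range_one, Finset.sum_filter_add_sum_filter_not]
    simp [level, pathProb]
  | succ k ih =>
    rw [Finset.sum_range_succ, add_assoc, Finset.sum_filter_add_sum_filter_not, sum_level_succ,
      ← ih]
    congr 1
    refine Finset.sum_congr rfl fun u hu => ?_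
    rw [Finset.mem_filter, mem_level] at hu
    exact t.sum_pathProb_children hu.1.1 hu.2

/-- If no leaf lay below `u`, the positive mass `pathProb u` would remain open at every depth, and
`convUpTo` would stay below `1 - pathProb u`. -/
theorem Regular.exists_leaf {t : EpsTree E A} (ht : t.Regular) {u : List ℕ} (hu : u ∈ t.dom) :
    ∃ s, s ++ u ∈ t.leaves := by
  classical
  by_contra! hs
  -- `F n` is the set of descendants of `u` exactly `n` levels below it.
  let F : ℕ → Finset (List ℕ) := fun n => Nat.rec {u} (fun _ F => t.next F) n
  have hF : ∀ n, ∀ v ∈ F n, v ∈ t.dom ∧ v.length = n + u.length ∧ ∃ s, v = s ++ u := by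
    intro n
    induction n with
    | zero =>
      intro v hv
      obtain rfl := Finset.mem_singleton.1 hv
      exact ⟨hu, by simp, [], rfl⟩
    | succ n ih =>
      intro v hv
      obtain ⟨hv, w, hw, i, rfl⟩ := (t.mem_next fun w hw => (ih w hw).1).1 hv
      obtain ⟨_, hl, s, rfl⟩ := ih w hw
      exact ⟨hv, by simp only [List.length_cons, hl]; omega, i :: s, rfl⟩
  have hsum : ∀ n, ∑ v ∈ F n, t.pathProb v = t.pathProb u := by
    intro n
    induction n with
    | zero => exact Finset.sum_singleton _ _
    | succ n ih =>
      rw [← ih]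
      change ∑ v ∈ t.next (F n), t.pathProb v = _
      rw [sum_next]
      refine Finset.sum_congr rfl fun v hv => ?_
      obtain ⟨h1, _, s, rfl⟩ := hF n v hv
      exact t.sum_pathProb_children h1 (hs s)
  have hle : ∀ n, t.convUpTo (n + u.length) ≤ 1 - t.pathProb u := by
    intro n
    have h1 := t.convUpTo_add_openMass (n + u.length)
    have h2 : t.pathProb u ≤ t.openMass (n + u.length) := by
      rw [← hsum n, openMass]
      refine Finset.sum_le_sum_of_subset_of_nonneg (fun v hv => ?_) fun v hv _ => ?_
      · obtain ⟨h1, h2, s, rfl⟩ := hF n v hv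
        exact Finset.mem_filter.2 ⟨t.mem_level.2 ⟨h1, h2⟩, hs s⟩
      · exact (t.pathProb_pos (t.mem_level.1 (Finset.mem_filter.1 hv).1).1).le
    linarith
  have := le_of_tendsto ((tendsto_add_atTop_iff_nat u.length).2 ht) (Eventually.of_forall hle)
  have := t.pathProb_pos hu
  linarith

theorem safeStep_lab {u : List ℕ} {i : ℕ} (h : i :: u ∈ t.dom) :
    SafeStep (t.lab '' t.dom) (t.lab u) (t.lab (i :: u)) := by
  rcases t.children u (t.parent_mem i u h) with h' | ⟨h', ht, _⟩ | ⟨k, p, Q, hc, h', hi⟩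
  · exact absurd h (h' i)
  · obtain rfl := (h' i).1 h
    exact Or.inl ⟨ht, _, h, rfl⟩
  · refine Or.inr ⟨k, p, Q, hc, fun j => ?_, ⟨i, (h' i).1 h⟩, (hi ⟨i, (h' i).1 h⟩).1.symm⟩
    exact ⟨(j : ℕ) :: u, (h' j).2 j.2, (hi j).1⟩

theorem Regular.conv {t : EpsTree E A} (ht : t.Regular) {S : Set (Proc 𝒜)}
    (hS : ∀ u ∈ t.leaves, t.lab u ∈ S) : Conv E A S := by
  refine ⟨t.lab '' t.dom, ⟨[], t.root_mem, t.root_lab⟩, ?_, ?_⟩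
  · rintro _ ⟨u, hu, rfl⟩
    exact t.lab_rel u hu
  · rintro _ ⟨u, hu, rfl⟩
    obtain ⟨s, hs⟩ := ht.exists_leaf hu
    refine ⟨_, hS _ hs, ?_⟩
    have : ∀ s : List ℕ, s ++ u ∈ t.dom →
        Relation.ReflTransGen (SafeStep (t.lab '' t.dom)) (t.lab u) (t.lab (s ++ u)) := by
      intro s
      induction s with
      | nil => exact fun _ => Relation.ReflTransGen.refl
      | cons i s ih => exact fun h => (ih (t.parent_mem i _ h)).tail (t.safeStep_lab h)
    exact this s hs.1

/-- A potential that decreases in expectation by a constant factor makes a tree regular. -/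
theorem regular_of_potential (φ : List ℕ → ℝ) (c : ℝ) (hc0 : 0 ≤ c) (hc1 : c < 1)
    (h1 : ∀ u ∈ t.dom, 1 ≤ φ u)
    (hφ : ∀ u ∈ t.dom, u ∉ t.leaves →
      ∑ i ∈ Finset.range (t.deg u), t.wt (i :: u) * φ (i :: u) ≤ c * φ u) : t.Regular := by
  classical
  -- The expected potential on level `k` decays geometrically, leaves contributing nothing to later
  -- levels; it dominates the open mass since `φ` is at least `1`.
  have hlev : ∀ k, ∑ u ∈ t.level k, t.pathProb u * φ u ≤ c ^ k * φ [] := by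
    intro k
    induction k with
    | zero => simp [level, pathProb]
    | succ k ih =>
      have hpos : ∀ u ∈ t.level k, 0 ≤ t.pathProb u * φ u := fun u hu => by
        have hu := (t.mem_level.1 hu).1
        have := h1 u hu
        have := t.pathProb_pos hu
        positivity
      calc ∑ v ∈ t.level (k + 1), t.pathProb v * φ v
          = ∑ u ∈ t.level k with u ∉ t.leaves, t.pathProb u *
              ∑ i ∈ Finset.range (t.deg u), t.wt (i :: u) * φ (i :: u) := by
            rw [sum_level_succ]
            refine Finset.sum_congr rfl fun u _ => ?_
            rw [Finset.mul_sum]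
            exact Finset.sum_congr rfl fun i _ => by simp only [pathProb]; ring
        _ ≤ ∑ u ∈ t.level k with u ∉ t.leaves, c * (t.pathProb u * φ u) := by
            refine Finset.sum_le_sum fun u hu => ?_
            rw [Finset.mem_filter, mem_level] at hu
            calc _ ≤ t.pathProb u * (c * φ u) :=
                  mul_le_mul_of_nonneg_left (hφ u hu.1.1 hu.2) (t.pathProb_pos hu.1.1).le
              _ = _ := by ring
        _ ≤ ∑ u ∈ t.level k, c * (t.pathProb u * φ u) :=
            Finset.sum_le_sum_of_subset_of_nonneg (Finset.filter_subset _ _)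
              fun u hu _ => mul_nonneg hc0 (hpos u hu)
        _ = c * ∑ u ∈ t.level k, t.pathProb u * φ u := (Finset.mul_sum _ _ _).symm
        _ ≤ c * (c ^ k * φ []) := mul_le_mul_of_nonneg_left ih hc0
        _ = c ^ (k + 1) * φ [] := by ring
  have hopen : ∀ k, t.openMass k ≤ c ^ k * φ [] := by
    intro k
    refine le_trans ?_ (hlev k)
    have hpos : ∀ u ∈ t.level k, t.pathProb u ≤ t.pathProb u * φ u := fun u hu =>
      have hu := (t.mem_level.1 hu).1
      le_mul_of_one_le_right (t.pathProb_pos hu).le (h1 u hu)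
    refine le_trans (Finset.sum_le_sum_of_subset_of_nonneg (Finset.filter_subset _ _)
      fun u hu _ => (t.pathProb_pos (t.mem_level.1 hu).1).le) (Finset.sum_le_sum hpos)
  have hnonneg : ∀ k, 0 ≤ t.openMass k := fun k =>
    Finset.sum_nonneg fun u hu => (t.pathProb_pos (t.mem_level.1 (Finset.mem_filter.1 hu).1).1).le
  have hlim : Tendsto t.openMass atTop (𝓝 0) := by
    refine squeeze_zero hnonneg hopen ?_
    simpa using (tendsto_pow_atTop_nhds_zero_of_lt_one hc0 hc1).mul_const (φ [])
  have : t.convUpTo = fun k => 1 - t.openMass k :=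
    funext fun k => by linarith [t.convUpTo_add_openMass k]
  rw [Regular, this]
  simpa using hlim.const_sub 1

end EpsTree

/-! ### Trees of memoryless strategies -/

/-- Labels of the tree that unfolds the successor function `q`. -/
def unfoldLab (A : Proc 𝒜) (q : Proc 𝒜 → ℕ → Proc 𝒜) : List ℕ → Proc 𝒜
  | [] => A
  | i :: u => q (unfoldLab A q u) i

/-- Nodes of the tree that unfolds the successor function `q` with `k X` successors of `X`. -/
def unfoldDom (A : Proc 𝒜) (k : Proc 𝒜 → ℕ) (q : Proc 𝒜 → ℕ → Proc 𝒜) : List ℕ → Prop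
  | [] => True
  | i :: u => unfoldDom A k q u ∧ i < k (unfoldLab A q u)

/-- The `k` successors `q 0, …, q (k - 1)` of `X`, with probabilities `p`, are those of a silent
transition, or `k = 0`. -/
def IsMove (X : Proc 𝒜) (k : ℕ) (p : ℕ → ℝ) (q : ℕ → Proc 𝒜) : Prop :=
  k = 0 ∨ (k = 1 ∧ X.Trans (Label.act Act.tau) (q 0) ∧ p 0 = 1) ∨
    ∃ (P : Fin k → ℝ) (Q : Fin k → Proc 𝒜), X.Coll k P Q ∧ ∀ i : Fin k, q i = Q i ∧ p i = P i

/-- Unfolding of a memoryless strategy. -/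
def unfoldTree (E : Setoid (Proc 𝒜)) (A : Proc 𝒜) (W : Set (Proc 𝒜)) (hA : A ∈ W)
    (hE : ∀ X ∈ W, E A X) (k : Proc 𝒜 → ℕ) (p : Proc 𝒜 → ℕ → ℝ) (q : Proc 𝒜 → ℕ → Proc 𝒜)
    (hmove : ∀ X ∈ W, IsMove X (k X) (p X) (q X)) (hW : ∀ X ∈ W, ∀ i < k X, q X i ∈ W) :
    EpsTree E A where
  dom := {u | unfoldDom A k q u}
  lab := unfoldLab A q
  wt
    | [] => 1
    | i :: u => p (unfoldLab A q u) i
  root_mem := trivial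
  parent_mem _ _ h := h.1
  root_lab := rfl
  lab_rel u hu := by
    refine hE _ ?_
    induction u with
    | nil => exact hA
    | cons i u ih => exact hW _ (ih hu.1) i hu.2
  children u hu := by
    have hmem : unfoldLab A q u ∈ W := by
      clear hmove
      induction u with
      | nil => exact hA
      | cons i u ih => exact hW _ (ih hu.1) i hu.2
    have hdom : ∀ i, unfoldDom A k q (i :: u) ↔ i < k (unfoldLab A q u) :=
      fun i => ⟨fun h => h.2, fun h => ⟨hu, h⟩⟩
    rcases hmove _ hmem with h | ⟨h, ht, hp⟩ | ⟨P, Q, hc, hi⟩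
    · exact Or.inl fun i hi => by
        have := (hdom i).1 hi
        omega
    · refine Or.inr (Or.inl ⟨fun i => (hdom i).trans (by rw [h]; exact Nat.lt_one_iff), ht, hp⟩)
    · exact Or.inr (Or.inr ⟨_, P, Q, hc, hdom, hi⟩)

theorem unfoldLab_mem {A : Proc 𝒜} {W : Set (Proc 𝒜)} (hA : A ∈ W) {k : Proc 𝒜 → ℕ}
    {q : Proc 𝒜 → ℕ → Proc 𝒜} (hW : ∀ X ∈ W, ∀ i < k X, q X i ∈ W) {u : List ℕ}
    (hu : unfoldDom A k q u) : unfoldLab A q u ∈ W := by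
  induction u with
  | nil => exact hA
  | cons i u ih => exact hW _ (ih hu.1) i hu.2

theorem SafeStep.exists_isMove {W : Set (Proc 𝒜)} {X Y : Proc 𝒜} (h : SafeStep W X Y) :
    ∃ (k : ℕ) (p : ℕ → ℝ) (q : ℕ → Proc 𝒜), IsMove X k p q ∧ (∀ i < k, q i ∈ W) ∧
      (∀ i < k, 0 < p i) ∧ ∑ i ∈ Finset.range k, p i = 1 ∧ ∃ i < k, q i = Y := by
  rcases h with ⟨ht, hY⟩ | ⟨k, P, Q, hc, hW, j, hj⟩
  · exact ⟨1, fun _ => 1, fun _ => Y, Or.inr (Or.inl ⟨rfl, ht, rfl⟩), fun _ _ => hY,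
      fun _ _ => one_pos, by simp, 0, one_pos, rfl⟩
  · refine ⟨k, fun i => if h : i < k then P ⟨i, h⟩ else 0,
      fun i => if h : i < k then Q ⟨i, h⟩ else Y, Or.inr (Or.inr ⟨P, Q, hc, ?_⟩), ?_, ?_, ?_, j,
      j.2, ?_⟩
    · intro i; simp
    · intro i hi; simp [hi, hW]
    · intro i hi; simpa [hi] using hc.pos _
    · rw [Finset.sum_range, ← hc.sum_eq]
      exact Finset.sum_congr rfl fun i _ => by simp
    · simpa using hj

/-- The rank is the length of a shortest path into `S`. The value `0` of `sInf` on the empty set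
does no harm, as only points with such a path are compared. -/
theorem exists_rank {α : Type*} (r : α → α → Prop) (S W : Set α)
    (h : ∀ X ∈ W, ∃ L ∈ S, Relation.ReflTransGen r X L) :
    ∃ rank : α → ℕ, ∀ X ∈ W, X ∉ S → ∃ Y, r X Y ∧ rank Y < rank X := by
  classical
  let D : ℕ → α → Prop := fun n => Nat.rec (fun X => X ∈ S) (fun _ D X => ∃ Y, r X Y ∧ D Y) n
  have hD : ∀ X L, L ∈ S → Relation.ReflTransGen r X L → ∃ n, D n X := by
    intro X L hL hXL
    induction hXL using Relation.ReflTransGen.head_induction_on with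
    | refl => exact ⟨0, hL⟩
    | head h _ ih => exact ⟨ih.choose + 1, _, h, ih.choose_spec⟩
  refine ⟨fun X => sInf {n | D n X}, fun X hX hXS => ?_⟩
  obtain ⟨L, hL, hXL⟩ := h X hX
  have hmem : D (sInf {n | D n X}) X := Nat.sInf_mem (s := {n | D n X}) (hD X L hL hXL)
  obtain ⟨n, hn⟩ : ∃ n, sInf {n | D n X} = n + 1 := by
    cases hn : sInf {n | D n X} with
    | zero => rw [hn] at hmem; exact absurd hmem hXS
    | succ n => exact ⟨n, rfl⟩
  rw [hn] at hmem
  obtain ⟨Y, hXY, hY⟩ := hmem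
  exact ⟨Y, hXY, by
    change _ < sInf {n | D n X}
    rw [hn]
    exact Nat.lt_succ_of_le (Nat.sInf_le (s := {n | D n Y}) hY)⟩

theorem exists_pos_lower_bound {T : Set ℝ} (hT : T.Finite) (h : ∀ x ∈ T, 0 < x) :
    ∃ δ : ℝ, 0 < δ ∧ δ ≤ 1 ∧ ∀ x ∈ T, δ ≤ x := by
  induction T, hT using Set.Finite.induction_on with
  | empty => exact ⟨1, one_pos, le_rfl, by simp⟩
  | @insert a T _ _ ih =>
    obtain ⟨δ, h0, h1, hδ⟩ := ih fun x hx => h x (Or.inr hx)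
    refine ⟨min a δ, lt_min (h a (Or.inl rfl)) h0, (min_le_right _ _).trans h1, ?_⟩
    rintro x (rfl | hx)
    · exact min_le_left _ _
    · exact (min_le_right _ _).trans (hδ x hx)

/-- A memoryless strategy suffices: stop in `S`, and elsewhere in `W` take a safe move with some
outcome of smaller rank. The other outcomes may have larger rank but stay in `W`, and finiteness of
`W` bounds below the chance of making progress. -/
theorem Conv.exists_regular {E : Setoid (Proc 𝒜)} {A : Proc 𝒜} {S : Set (Proc 𝒜)}
    (h : Conv E A S) : ∃ t : EpsTree E A, t.Regular ∧ ∀ u ∈ t.leaves, t.lab u ∈ S := by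
  classical
  obtain ⟨W, hWR, hA, hWE, hW⟩ := h.restrict (R := Reach A) (fun X hX l Y hl => Reach.tail hX hl)
    (Reach.refl A)
  have hfin : W.Finite := (finite_reach A).subset hWR
  obtain ⟨rank, hrank⟩ := exists_rank (SafeStep W) S W hW
  have hex : ∀ X : Proc 𝒜, ∃ (k : ℕ) (p : ℕ → ℝ) (q : ℕ → Proc 𝒜),
      (X ∈ W → IsMove X k p q ∧ (∀ i < k, q i ∈ W) ∧ (∀ i < k, 0 < p i) ∧
        (k = 0 → X ∈ S) ∧ (k ≠ 0 → ∑ i ∈ Finset.range k, p i = 1 ∧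
          ∃ i < k, rank (q i) < rank X)) := by
    intro X
    by_cases hX : X ∈ W ∧ X ∉ S
    · obtain ⟨Y, hXY, hY⟩ := hrank X hX.1 hX.2
      obtain ⟨k, p, q, h1, h2, h3, h4, i, hi, rfl⟩ := hXY.exists_isMove
      exact ⟨k, p, q, fun _ => ⟨h1, h2, h3, fun h0 => by omega, fun _ => ⟨h4, i, hi, hY⟩⟩⟩
    · refine ⟨0, fun _ => 0, fun _ => X, fun hX' => ⟨Or.inl rfl, by simp, by simp, fun _ => ?_,
        by simp⟩⟩
      by_contra hS
      exact hX ⟨hX', hS⟩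
  choose k p q hkpq using hex
  have hmove : ∀ X ∈ W, IsMove X (k X) (p X) (q X) := fun X hX => (hkpq X hX).1
  have hqW : ∀ X ∈ W, ∀ i < k X, q X i ∈ W := fun X hX => (hkpq X hX).2.1
  let t := unfoldTree E A W hA hWE k p q hmove hqW
  have hlab : ∀ u ∈ t.dom, t.lab u ∈ W := fun u hu => unfoldLab_mem hA hqW hu
  have hdeg : ∀ u ∈ t.dom, t.deg u = k (t.lab u) := by
    intro u hu
    have : ∀ i, i < t.deg u ↔ i < k (t.lab u) := fun i => by
      rw [← t.mem_dom_iff_lt_deg hu]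
      exact ⟨fun h => h.2, fun h => ⟨hu, h⟩⟩
    exact le_antisymm (not_lt.1 fun h => lt_irrefl _ ((this _).1 h))
      (not_lt.1 fun h => lt_irrefl _ ((this _).2 h))
  refine ⟨t, ?_, fun u hu => ?_⟩
  · obtain ⟨δ, hδ0, hδ1, hδ⟩ := exists_pos_lower_bound
      (T := ⋃ X ∈ W, (fun i => p X i) '' (Finset.range (k X) : Set ℕ))
      (hfin.biUnion fun X _ => (Finset.finite_toSet _).image _) (by
        simp only [Set.mem_iUnion]
        rintro x ⟨X, hX, i, hi, rfl⟩
        exact (hkpq X hX).2.2.1 i (by simpa using hi))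
    obtain ⟨N, hN⟩ := (hfin.image rank).bddAbove
    -- The potential is `2 - ε ^ rank`. A move hits a smaller rank with probability at least `δ = 2
    -- * ε`, so the expectation of `ε ^ rank` at least doubles. The potential thus drops by at least
    -- `ε ^ N`; being at most `2`, it shrinks by the factor `1 - ε ^ N / 2`.
    set ε := δ / 2 with hε
    have hε0 : 0 < ε := by positivity
    have hε1 : ε ≤ 1 := by linarith
    have hεN0 : 0 < ε ^ N := by positivity
    have hεN1 : ε ^ N ≤ 1 := pow_le_one₀ hε0.le hε1
    refine t.regular_of_potential (fun u => 2 - ε ^ rank (t.lab u)) (1 - ε ^ N / 2)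
      (by linarith) (by linarith) (fun u _ => ?_) fun u hu hul => ?_
    · have : ε ^ rank (t.lab u) ≤ 1 := pow_le_one₀ hε0.le hε1
      linarith
    · have hX := hlab u hu
      rw [hdeg u hu]
      change ∑ i ∈ Finset.range (k (t.lab u)), p (t.lab u) i *
        (2 - ε ^ rank (q (t.lab u) i)) ≤ (1 - ε ^ N / 2) * (2 - ε ^ rank (t.lab u))
      have hk0 : k (t.lab u) ≠ 0 := fun h0 =>
        hul ⟨hu, fun i hi => by
          have : i < k (t.lab u) := hi.2
          omega⟩
      have hrN : rank (t.lab u) ≤ N := hN ⟨_, hX, rfl⟩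
      generalize t.lab u = X at hX hk0 hrN
      obtain ⟨_, _, hp, _, hs⟩ := hkpq X hX
      obtain ⟨hsum, j, hj, hjr⟩ := hs hk0
      have hpj : δ ≤ p X j := hδ _ (Set.mem_iUnion₂.2 ⟨X, hX, j, by simpa using hj, rfl⟩)
      have h1 : p X j * ε ^ rank (q X j) ≤
          ∑ i ∈ Finset.range (k X), p X i * ε ^ rank (q X i) :=
        Finset.single_le_sum (f := fun i => p X i * ε ^ rank (q X i))
          (fun i hi => mul_nonneg (hp i (Finset.mem_range.1 hi)).le (pow_nonneg hε0.le _))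
          (Finset.mem_range.2 hj)
      have h2 : ∑ i ∈ Finset.range (k X), p X i * (2 - ε ^ rank (q X i)) =
          2 - ∑ i ∈ Finset.range (k X), p X i * ε ^ rank (q X i) := by
        simp only [mul_sub, Finset.sum_sub_distrib]
        rw [← Finset.sum_mul, hsum, one_mul]
      have h3 : 2 * ε ^ rank X ≤ p X j * ε ^ rank (q X j) := by
        calc 2 * ε ^ rank X ≤ 2 * ε ^ (rank (q X j) + 1) :=
              mul_le_mul_of_nonneg_left (pow_le_pow_of_le_one hε0.le hε1 hjr) (by norm_num)
          _ = δ * ε ^ rank (q X j) := by rw [pow_succ, hε]; ring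
          _ ≤ _ := mul_le_mul_of_nonneg_right hpj (pow_nonneg hε0.le _)
      have h4 : ε ^ N ≤ ε ^ rank X := pow_le_pow_of_le_one hε0.le hε1 hrN
      have h5 : 0 < ε ^ rank X := by positivity
      rw [h2]
      nlinarith
  · refine (hkpq _ (hlab u hu.1)).2.2.2.1 ?_
    rw [← hdeg u hu.1, t.deg_eq_zero hu]

/-- A set of processes is reached by a regular `ε`-tree iff it is almost surely reachable. -/
theorem exists_regular_iff_conv {E : Setoid (Proc 𝒜)} {A : Proc 𝒜} {S : Set (Proc 𝒜)} :
    (∃ t : EpsTree E A, t.Regular ∧ ∀ u ∈ t.leaves, t.lab u ∈ S) ↔ Conv E A S :=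
  ⟨fun ⟨_, ht, hS⟩ => ht.conv hS, Conv.exists_regular⟩

/-! ### Probability of sets of targets -/

open Classical in
/-- The probability that a collective silent transition with probabilities `p` and targets `Q`
arrives in `g`. -/
noncomputable def mass {k : ℕ} (p : Fin k → ℝ) (Q : Fin k → Proc 𝒜) (g : Proc 𝒜 → Prop) : ℝ :=
  ∑ i, if g (Q i) then p i else 0

theorem arriveProb_eq_mass (E : Setoid (Proc 𝒜)) {k : ℕ} (p : Fin k → ℝ) (Q : Fin k → Proc 𝒜)
    (Z : Proc 𝒜) : arriveProb E p Q (Quotient.mk E Z) = mass p Q fun Y => E Y Z := by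
  classical
  refine Finset.sum_congr rfl fun i _ => ?_
  have : (Quotient.mk E (Q i) = Quotient.mk E Z) ↔ E (Q i) Z := Quotient.eq
  simp only [this]

theorem mass_congr {k : ℕ} {p : Fin k → ℝ} {Q : Fin k → Proc 𝒜} {g g' : Proc 𝒜 → Prop}
    (h : ∀ i, g (Q i) ↔ g' (Q i)) : mass p Q g = mass p Q g' := by
  refine Finset.sum_congr rfl fun i _ => ?_
  by_cases hi : g (Q i)
  · simp [hi, (h i).1 hi]
  · simp [hi, mt (h i).2 hi]

theorem mass_eq_zero {k : ℕ} {p : Fin k → ℝ} {Q : Fin k → Proc 𝒜} {g : Proc 𝒜 → Prop}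
    (h : ∀ i, ¬ g (Q i)) : mass p Q g = 0 := by
  simp [mass, h]

theorem Proc.Coll.mass_pos_iff {X : Proc 𝒜} {k : ℕ} {p : Fin k → ℝ} {Q : Fin k → Proc 𝒜}
    (h : X.Coll k p Q) (g : Proc 𝒜 → Prop) : 0 < mass p Q g ↔ ∃ i, g (Q i) := by
  classical
  constructor
  · intro hpos
    by_contra! hn
    exact hpos.ne' (mass_eq_zero hn)
  · rintro ⟨i, hi⟩
    refine Finset.sum_pos' (fun j _ => ?_) ⟨i, Finset.mem_univ i, ?_⟩
    · split_ifs
      exacts [(h.pos j).le, le_rfl]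
    · simpa [hi] using h.pos i

theorem Proc.Coll.one_sub_mass {X : Proc 𝒜} {k : ℕ} {p : Fin k → ℝ} {Q : Fin k → Proc 𝒜}
    (h : X.Coll k p Q) (g : Proc 𝒜 → Prop) : 1 - mass p Q g = mass p Q fun Y => ¬ g Y := by
  rw [← h.sum_eq, mass, mass, ← Finset.sum_sub_distrib]
  refine Finset.sum_congr rfl fun i _ => ?_
  by_cases hi : g (Q i) <;> simp [hi]

-- `T` only has to contain the classes that are hit, so that one index set can serve two transitions
-- at once.
open Classical in
theorem mass_eq_sum_classes (E : Setoid (Proc 𝒜)) {k : ℕ} (p : Fin k → ℝ) (Q : Fin k → Proc 𝒜)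
    {g : Proc 𝒜 → Prop} (hg : ∀ X Y, E X Y → g X → g Y) (T : Finset (Quotient E))
    (hT : ∀ i, Quotient.mk E (Q i) ∈ T) :
    mass p Q g = ∑ c ∈ T, if g c.out then mass p Q (fun Y => E Y c.out) else 0 := by
  have hout : ∀ X, E (Quotient.mk E X).out X := fun X => Quotient.mk_out X
  have hmk : ∀ (X : Proc 𝒜) (c : Quotient E), E X c.out ↔ Quotient.mk E X = c := by
    intro X c
    refine Iff.trans (b := Quotient.mk E X = Quotient.mk E c.out) Quotient.eq.symm ?_
    rw [Quotient.out_eq]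
  have : ∀ c ∈ T, (if g c.out then mass p Q (fun Y => E Y c.out) else 0) =
      ∑ i, if Quotient.mk E (Q i) = c then (if g (Q i) then p i else 0) else 0 := by
    intro c _
    split_ifs with hc
    · refine Finset.sum_congr rfl fun i _ => ?_
      simp only [hmk]
      split_ifs with h1 h2
      · rfl
      · exact absurd (hg _ _ (E.symm ((hmk _ _).2 h1)) hc) h2
      · rfl
    · refine (Finset.sum_eq_zero fun i _ => ?_).symm
      split_ifs with h1 h2
      · exact absurd (hg _ _ ((hmk _ _).2 h1) h2) hc
      · rfl
      · rfl
  rw [Finset.sum_congr rfl this, Finset.sum_comm]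
  refine Finset.sum_congr rfl fun i _ => ?_
  rw [Finset.sum_ite_eq, if_pos (hT i)]

/-- Proportionality of masses extends from the classes of an equivalence to unions of classes. -/
theorem mass_proportional (E : Setoid (Proc 𝒜)) {k : ℕ} {p : Fin k → ℝ} {Q : Fin k → Proc 𝒜}
    {k' : ℕ} {p' : Fin k' → ℝ} {Q' : Fin k' → Proc 𝒜} {a a' : ℝ} {g : Proc 𝒜 → Prop}
    (hg : ∀ X Y, E X Y → g X → g Y)
    (h : ∀ Z, g Z → mass p Q (fun Y => E Y Z) * a' = mass p' Q' (fun Y => E Y Z) * a) :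
    mass p Q g * a' = mass p' Q' g * a := by
  classical
  let T : Finset (Quotient E) := Finset.univ.image (fun i => Quotient.mk E (Q i)) ∪
    Finset.univ.image fun i => Quotient.mk E (Q' i)
  rw [mass_eq_sum_classes E p Q hg T fun i => by simp [T],
    mass_eq_sum_classes E p' Q' hg T fun i => by simp [T], Finset.sum_mul, Finset.sum_mul]
  refine Finset.sum_congr rfl fun c _ => ?_
  split_ifs with hc
  · exact h _ hc
  · simp

/-! ### Transitions to classes in terms of almost sure reachability -/

/-- The processes with an `l`-transition into the class `C`. -/
def actSet (E : Setoid (Proc 𝒜)) (l : Act 𝒜) (C : Quotient E) : Set (Proc 𝒜) :=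
  {L | ∃ L' : Proc 𝒜, L.Trans (Label.act l) L' ∧ Quotient.mk E L' = C}

/-- The processes with a collective silent transition that leaves the class and arrives at `C` with
conditional probability `q`. -/
def probSet (E : Setoid (Proc 𝒜)) (q : ℝ) (C : Quotient E) : Set (Proc 𝒜) :=
  {L | ∃ (k : ℕ) (p : Fin k → ℝ) (Q : Fin k → Proc 𝒜), L.Coll k p Q ∧
    arriveProb E p Q (Quotient.mk E L) < 1 ∧
    arriveProb E p Q C / (1 - arriveProb E p Q (Quotient.mk E L)) = q}

theorem lTrans_iff {E : Setoid (Proc 𝒜)} {A : Proc 𝒜} {l : Act 𝒜} {C : Quotient E} :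
    LTrans E A l C ↔ ((∃ a, l = Act.ext a) ∨ (l = Act.tau ∧ C ≠ Quotient.mk E A)) ∧
      Conv E A (actSet E l C) :=
  and_congr_right fun _ => exists_regular_iff_conv (S := actSet E l C)

theorem qTrans_iff {E : Setoid (Proc 𝒜)} {A : Proc 𝒜} {q : ℝ} {C : Quotient E} :
    QTrans E A q C ↔ C ≠ Quotient.mk E A ∧ Conv E A (probSet E q C) :=
  and_congr_right fun _ => exists_regular_iff_conv (S := probSet E q C)

/-- The probability of leaving becomes the mass of the complement of the class, which is positive
exactly when some target lies outside. -/
theorem mem_probSet_iff {E : Setoid (Proc 𝒜)} {q : ℝ} {Z L : Proc 𝒜} :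
    L ∈ probSet E q (Quotient.mk E Z) ↔
      ∃ (k : ℕ) (p : Fin k → ℝ) (Q : Fin k → Proc 𝒜), L.Coll k p Q ∧ (∃ j, ¬ E (Q j) L) ∧
        mass p Q (fun Y => E Y Z) / mass p Q (fun Y => ¬ E Y L) = q := by
  refine exists_congr fun k => exists_congr fun p => exists_congr fun Q =>
    and_congr_right fun hc => ?_
  rw [arriveProb_eq_mass, arriveProb_eq_mass, ← sub_pos, hc.one_sub_mass, hc.mass_pos_iff]

theorem Conv.of_mem {E : Setoid (Proc 𝒜)} {A : Proc 𝒜} {S : Set (Proc 𝒜)} (h : A ∈ S) :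
    Conv E A S := by
  refine ⟨{A}, rfl, ?_, ?_⟩
  · rintro X rfl
    exact E.refl X
  · rintro X rfl
    exact ⟨X, h, Relation.ReflTransGen.refl⟩

theorem Conv.mono {E : Setoid (Proc 𝒜)} {A : Proc 𝒜} {S S' : Set (Proc 𝒜)}
    (hS : ∀ L, E A L → L ∈ S → L ∈ S') (h : Conv E A S) : Conv E A S' := by
  obtain ⟨W, hA, hE, hW⟩ := h
  refine ⟨W, hA, hE, fun X hX => ?_⟩
  obtain ⟨L, hL, hXL⟩ := hW X hX
  exact ⟨L, hS L (hE L (mem_of_reflTransGen_safeStep hX hXL)) hL, hXL⟩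

/-- The only silent move of `A` is its collective transition, which may leave the class and hence
every admissible region. So the strategy has to stop at `A` at once. -/
theorem Conv.mem_of_leaves {E : Setoid (Proc 𝒜)} {A : Proc 𝒜} {S : Set (Proc 𝒜)} (h : Conv E A S)
    {k : ℕ} {p : Fin k → ℝ} {Q : Fin k → Proc 𝒜} (hc : A.Coll k p Q) (hj : ∃ j, ¬ E (Q j) A) :
    A ∈ S := by
  obtain ⟨W, hA, hE, hW⟩ := h
  obtain ⟨L, hL, hAL⟩ := hW A hA
  rcases hAL.cases_head with rfl | ⟨Y, hY, _⟩
  · exact hL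
  · rcases hY with hY | ⟨k', p', Q', hc', hQ', _⟩
    · exact absurd hY.1 (hc.not_act _ _)
    · obtain ⟨rfl, h⟩ := Sigma.mk.inj (hc.unique hc')
      obtain ⟨rfl, rfl⟩ := Prod.mk.inj (eq_of_heq h)
      obtain ⟨j, hj⟩ := hj
      exact absurd (E.symm (hE _ (hQ' j))) hj

/-- Bisimilar processes leave their class by collective silent transitions with the same conditional
probabilities. -/
theorem IsBranchingBisim.conv_leave {E : Setoid (Proc 𝒜)} (hE : IsBranchingBisim E) {A B : Proc 𝒜}
    (hAB : E A B) {k : ℕ} {p : Fin k → ℝ} {Q : Fin k → Proc 𝒜} (hc : A.Coll k p Q)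
    (hj : ∃ j, ¬ E (Q j) A) :
    Conv E B {L | ∃ (k' : ℕ) (p' : Fin k' → ℝ) (Q' : Fin k' → Proc 𝒜), L.Coll k' p' Q' ∧
      (∃ j, ¬ E (Q' j) A) ∧ ∀ Z, ¬ E Z A →
        mass p Q (fun Y => E Y Z) * mass p' Q' (fun Y => ¬ E Y A) =
          mass p' Q' (fun Y => E Y Z) * mass p Q (fun Y => ¬ E Y A)} := by
  have key : ∀ X, E A X → ∀ Z, ¬ E Z A → Conv E X (probSet E
      (mass p Q (fun Y => E Y Z) / mass p Q (fun Y => ¬ E Y A)) (Quotient.mk E Z)) := by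
    intro X hX Z hZ
    refine (qTrans_iff.1 ((hE A X hX).2 _ _ (qTrans_iff.2 ⟨?_, Conv.of_mem ?_⟩))).2
    · exact fun h => hZ (Quotient.eq.1 h)
    · exact mem_probSet_iff.2 ⟨k, p, Q, hc, hj, rfl⟩
  obtain ⟨j, hj⟩ := hj
  -- The `q`-transitions to different classes come with different trees. The tree for the single
  -- class of `Q j` supplies `L`; as `L` can leave its class by its unique collective transition,
  -- `Conv.mem_of_leaves` makes that transition realise the ratios for all other `Z` as well.
  refine (key B hAB _ hj).mono fun L hBL hL => ?_
  have hAL := E.trans hAB hBL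
  have hiff : ∀ Y, ¬ E Y L ↔ ¬ E Y A := fun Y =>
    not_congr ⟨fun h => E.trans h (E.symm hAL), fun h => E.trans h hAL⟩
  obtain ⟨k', p', Q', hc', ⟨j', hj'⟩, _⟩ := mem_probSet_iff.1 hL
  refine ⟨k', p', Q', hc', ⟨j', (hiff _).1 hj'⟩, fun Z hZ => ?_⟩
  obtain ⟨k'', p'', Q'', hc'', _, h⟩ :=
    mem_probSet_iff.1 ((key L hAL Z hZ).mem_of_leaves hc' ⟨j', hj'⟩)
  obtain ⟨rfl, h'⟩ := Sigma.mk.inj (hc'.unique hc'')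
  obtain ⟨rfl, rfl⟩ := Prod.mk.inj (eq_of_heq h')
  simp only [hiff] at h
  rw [div_eq_div_iff] at h
  · exact h.symm
  · exact ((hc'.mass_pos_iff _).2 ⟨j', (hiff _).1 hj'⟩).ne'
  · exact ((hc.mass_pos_iff _).2 ⟨j, hj⟩).ne'

/-- A coarser equivalence inherits almost sure reachability along a branching bisimulation. -/
theorem IsBranchingBisim.conv_transfer {F E : Setoid (Proc 𝒜)} (hF : IsBranchingBisim F)
    (hle : F ≤ E) {A B : Proc 𝒜} (hAB : F A B) {S : Set (Proc 𝒜)}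
    (hS : ∀ X ∈ S, E A X → ∀ Y, F X Y → Conv F Y S) (h : Conv E A S) : Conv E B S := by
  obtain ⟨W, hAW, hWE, hW⟩ := h
  -- The region for `B` is the `F`-saturation of the region for `A`. Paths are imitated step by
  -- step, since all `ε`-trees with regard to `F` from related processes stay inside it.
  set W' : Set (Proc 𝒜) := {Y | ∃ X ∈ W, F X Y} with hW'
  have hlift : ∀ {X Y : Proc 𝒜} {S' : Set (Proc 𝒜)}, X ∈ W → F X Y → Conv F Y S' →
      ∃ L ∈ S', F X L ∧ Relation.ReflTransGen (SafeStep W') Y L := by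
    rintro X Y S' hX hXY ⟨V, hYV, hVE, hV⟩
    obtain ⟨L, hL, hYL⟩ := hV Y hYV
    refine ⟨L, hL, F.trans hXY (hVE _ (mem_of_reflTransGen_safeStep hYV hYL)), ?_⟩
    exact Relation.ReflTransGen.mono
      (fun _ _ h => SafeStep.mono (W' := W') (fun Z hZ => ⟨X, hX, F.trans hXY (hVE Z hZ)⟩) h)
      _ _ hYL
  refine ⟨W', ⟨A, hAW, hAB⟩, ?_, ?_⟩
  · rintro Y ⟨X, hX, hXY⟩
    exact E.trans (E.symm (hle hAB)) (E.trans (hWE X hX) (hle hXY))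
  rintro Y ⟨X, hX, hXY⟩
  obtain ⟨L, hL, hXL⟩ := hW X hX
  induction hXL using Relation.ReflTransGen.head_induction_on generalizing Y with
  | refl =>
    obtain ⟨M, hM, _, hYM⟩ := hlift hX hXY (hS L hL (hWE L hX) Y hXY)
    exact ⟨M, hM, hYM⟩
  | @head X X' hstep hrest ih =>
    have hX' : X' ∈ W := hstep.mem
    -- A step inside the `F`-class is answered by staying at `Y`.
    by_cases hXX' : F X' X
    · exact ih Y hX' (F.trans hXX' hXY)
    rcases hstep with ⟨ht, _⟩ | ⟨k, p, Q, hc, hQ, i, rfl⟩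
    · have hl : LTrans F X Act.tau (Quotient.mk F X') :=
        lTrans_iff.2 ⟨Or.inr ⟨rfl, fun h => hXX' (Quotient.eq.1 h)⟩, Conv.of_mem ⟨X', ht, rfl⟩⟩
      obtain ⟨L, ⟨L', hLL', hL'⟩, _, hYL⟩ :=
        hlift hX hXY (lTrans_iff.1 ((hF X Y hXY).1 _ _ hl)).2
      have hL'X : F X' L' := F.symm (Quotient.eq.1 hL')
      obtain ⟨M, hM, hLM⟩ := ih L' hX' hL'X
      exact ⟨M, hM, hYL.trans (Relation.ReflTransGen.head (Or.inl ⟨hLL', X', hX', hL'X⟩) hLM)⟩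
    · obtain ⟨L, ⟨k', p', Q', hc', ⟨j, hj⟩, hr⟩, _, hYL⟩ :=
        hlift hX hXY (hF.conv_leave hXY hc ⟨i, hXX'⟩)
      have hpos : 0 < mass p Q (fun Y => ¬ F Y X) := (hc.mass_pos_iff _).2 ⟨i, hXX'⟩
      have hpos' : 0 < mass p' Q' (fun Y => ¬ F Y X) := (hc'.mass_pos_iff _).2 ⟨j, hj⟩
      -- By proportionality, a class outside that of `X` that the answering transition hits is hit
      -- by the given transition too, so it contains some `Q i'` in `W`.
      have hQ' : ∀ j, Q' j ∈ W' := by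
        intro j
        by_cases hj : F (Q' j) X
        · exact ⟨X, hX, F.symm hj⟩
        · have h1 : 0 < mass p' Q' (fun Y => F Y (Q' j)) := (hc'.mass_pos_iff _).2 ⟨j, F.refl _⟩
          have h2 := hr _ hj
          have h3 : 0 < mass p Q (fun Y => F Y (Q' j)) := by
            have : 0 < mass p Q (fun Y => F Y (Q' j)) * mass p' Q' (fun Y => ¬ F Y X) := by
              rw [h2]; exact mul_pos h1 hpos
            exact pos_of_mul_pos_left this hpos'.le
          obtain ⟨i', hi'⟩ := (hc.mass_pos_iff _).1 h3
          exact ⟨Q i', hQ i', hi'⟩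
      have h3 : 0 < mass p' Q' (fun Y => F Y (Q i)) := by
        have h1 : 0 < mass p Q (fun Y => F Y (Q i)) := (hc.mass_pos_iff _).2 ⟨i, F.refl _⟩
        have : 0 < mass p' Q' (fun Y => F Y (Q i)) * mass p Q (fun Y => ¬ F Y X) := by
          rw [← hr _ hXX']; exact mul_pos h1 hpos'
        exact pos_of_mul_pos_left this hpos.le
      obtain ⟨j', hj'⟩ := (hc'.mass_pos_iff _).1 h3
      obtain ⟨M, hM, hLM⟩ := ih (Q' j') hX' (F.symm hj')
      exact ⟨M, hM, hYL.trans
        (Relation.ReflTransGen.head (Or.inr ⟨k', p', Q', hc', hQ', j', rfl⟩) hLM)⟩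

/-! ### The largest branching bisimulation contained in an equivalence -/

/-- Equality of the transitions to the classes of `E`. -/
def stepSetoid (E : Setoid (Proc 𝒜)) : Setoid (Proc 𝒜) where
  r A B := E A B ∧ (∀ l C, LTrans E A l C ↔ LTrans E B l C) ∧
    ∀ q C, QTrans E A q C ↔ QTrans E B q C
  iseqv :=
    { refl := fun A => ⟨E.refl A, fun _ _ => Iff.rfl, fun _ _ => Iff.rfl⟩
      symm := fun h =>
        ⟨E.symm h.1, fun l C => (h.2.1 l C).symm, fun q C => (h.2.2 q C).symm⟩
      trans := fun h h' => ⟨E.trans h.1 h'.1, fun l C => (h.2.1 l C).trans (h'.2.1 l C),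
        fun q C => (h.2.2 q C).trans (h'.2.2 q C)⟩ }

theorem isBranchingBisim_of_le {E : Setoid (Proc 𝒜)} (h : E ≤ stepSetoid E) :
    IsBranchingBisim E := fun _ _ hAB =>
  ⟨fun l C => ((h hAB).2.1 l C).1, fun q C => ((h hAB).2.2 q C).1⟩

theorem le_stepSetoid {F E : Setoid (Proc 𝒜)} (hle : F ≤ E)
    (h : ∀ A B, F A B → (∀ l C, LTrans E A l C → LTrans E B l C) ∧
      ∀ q C, QTrans E A q C → QTrans E B q C) : F ≤ stepSetoid E := fun A B hAB =>
  ⟨hle hAB, fun l C => ⟨(h A B hAB).1 l C, (h B A (F.symm hAB)).1 l C⟩,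
    fun q C => ⟨(h A B hAB).2 q C, (h B A (F.symm hAB)).2 q C⟩⟩

/-- The bisimulation condition for `F` speaks of `F`-classes; here it is carried to the classes of a
coarser `E`. Applied to `E = sSup 𝓕`, it gives closure under suprema. -/
theorem IsBranchingBisim.le_stepSetoid {F E : Setoid (Proc 𝒜)} (hF : IsBranchingBisim F)
    (hle : F ≤ E) : F ≤ stepSetoid E := by
  refine RCCS.le_stepSetoid hle fun A B hAB => ⟨fun l C h => ?_, fun q C h => ?_⟩
  · have hAB' : Quotient.mk E A = Quotient.mk E B := Quotient.eq.2 (hle hAB)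
    rw [lTrans_iff] at h ⊢
    refine ⟨hAB' ▸ h.1, hF.conv_transfer hle hAB ?_ h.2⟩
    rintro X ⟨L, hXL, rfl⟩ hAX Y hXY
    have hl : LTrans F X l (Quotient.mk F L) := by
      refine lTrans_iff.2 ⟨h.1.imp_right fun h' => ⟨h'.1, fun he => h'.2 ?_⟩,
        Conv.of_mem ⟨L, hXL, rfl⟩⟩
      exact Quotient.eq.2 (E.trans (hle (Quotient.eq.1 he)) (E.symm hAX))
    refine (lTrans_iff.1 ((hF X Y hXY).1 _ _ hl)).2.mono ?_
    rintro M _ ⟨M', hM, hM'⟩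
    exact ⟨M', hM, Quotient.eq.2 (hle (Quotient.eq.1 hM'))⟩
  · have hAB' : Quotient.mk E A = Quotient.mk E B := Quotient.eq.2 (hle hAB)
    induction C using Quotient.inductionOn with | h Z => ?_
    rw [qTrans_iff] at h ⊢
    refine ⟨hAB' ▸ h.1, hF.conv_transfer hle hAB ?_ h.2⟩
    intro X hX hAX Y hXY
    have hZA : ¬ E Z A := fun hZ => h.1 (Quotient.eq.2 hZ)
    have hZX : ¬ E Z X := fun hZ => hZA (E.trans hZ (E.symm hAX))
    obtain ⟨k, p, Q, hc, ⟨j, hj⟩, rfl⟩ := mem_probSet_iff.1 hX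
    refine (hF.conv_leave hXY hc ⟨j, fun h => hj (hle h)⟩).mono ?_
    rintro L hYL ⟨k', p', Q', hc', ⟨j', hj'⟩, hr⟩
    have hXL : E X L := E.trans (hle hXY) (hle hYL)
    have hiff : ∀ Y, ¬ E Y L ↔ ¬ E Y X := fun Y =>
      not_congr ⟨fun h => E.trans h (E.symm hXL), fun h => E.trans h hXL⟩
    have ha : 0 < mass p Q (fun Y => ¬ F Y X) := (hc.mass_pos_iff _).2 ⟨j, fun h => hj (hle h)⟩
    have ha' : 0 < mass p' Q' (fun Y => ¬ F Y X) := (hc'.mass_pos_iff _).2 ⟨j', hj'⟩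
    have hn : 0 < mass p Q (fun Y => ¬ E Y X) := (hc.mass_pos_iff _).2 ⟨j, hj⟩
    -- Numerator and denominator of the conditional probability with regard to `E` are masses of
    -- unions of `F`-classes that avoid the `F`-class of `X`. Both scale by the same factor, so the
    -- quotient is unchanged.
    have e1 := mass_proportional F (g := fun Y => E Y Z)
      (fun X Y h hX => E.trans (E.symm (hle h)) hX)
      fun V hV => hr V fun h => hZX (E.trans (E.symm hV) (hle h))
    have e2 := mass_proportional F (g := fun Y => ¬ E Y X)
      (fun U V h hU hV => hU (E.trans (hle h) hV))
      fun V hV => hr V fun h => hV (hle h)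
    have hn' : 0 < mass p' Q' (fun Y => ¬ E Y X) := by
      have : 0 < mass p' Q' (fun Y => ¬ E Y X) * mass p Q (fun Y => ¬ F Y X) := by
        rw [← e2]; exact mul_pos hn ha'
      exact pos_of_mul_pos_left this ha.le
    refine mem_probSet_iff.2 ⟨k', p', Q', hc', ?_, ?_⟩
    · obtain ⟨i, hi⟩ := (hc'.mass_pos_iff _).1 hn'
      exact ⟨i, (hiff _).2 hi⟩
    · simp only [hiff]
      rw [div_eq_div_iff hn'.ne' hn.ne']
      refine mul_right_cancel₀ (mul_pos ha ha').ne' ?_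
      linear_combination (-mass p Q (fun Y => ¬ E Y X) * mass p' Q' (fun Y => ¬ F Y X)) * e1 +
        (mass p Q (fun Y => E Y Z) * mass p' Q' (fun Y => ¬ F Y X)) * e2

theorem isBranchingBisim_sSup {𝓕 : Set (Setoid (Proc 𝒜))} (h : ∀ F ∈ 𝓕, IsBranchingBisim F) :
    IsBranchingBisim (sSup 𝓕) :=
  isBranchingBisim_of_le (sSup_le fun F hF => (h F hF).le_stepSetoid (le_sSup hF))

theorem exists_isQuotient (Eini : Setoid (Proc 𝒜)) : ∃ E, IsQuotient Eini E :=
  ⟨sSup {F | IsBranchingBisim F ∧ F ≤ Eini},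
    ⟨isBranchingBisim_sSup fun _ hF => hF.1, sSup_le fun _ hF => hF.2⟩, fun _ hF => le_sSup hF⟩

/-! ### `τ`-end components and branching bisimulations -/

/-- The closure condition on collective transitions is what makes every edge of a `τ`-EC a safe step
within its vertices. -/
theorem IsTauEC.reflTransGen_safeStep {X : Proc 𝒜} {ec : LGraph 𝒜} (h : IsTauEC X ec)
    {Y Z : Proc 𝒜} (hY : Y ∈ ec.V) (hZ : Z ∈ ec.V) :
    Relation.ReflTransGen (SafeStep ec.V) Y Z := by
  refine Relation.ReflTransGen.mono ?_ _ _ (h.connected Y hY Z hZ).to_reflTransGen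
  rintro U V ⟨l, hl⟩
  have hs := h.silent _ _ _ hl
  cases l with
  | act α =>
    cases α with
    | tau => exact Or.inl ⟨(h.edge _ _ _ hl).2.2, (h.edge _ _ _ hl).2.1⟩
    | ext a => exact hs.elim
  | prob q =>
    obtain ⟨k, p, Q, hc, ⟨i, _, hi⟩, hQ⟩ := h.coll _ _ _ hl
    exact Or.inr ⟨k, p, Q, hc, fun i => (h.edge _ _ _ (hQ i)).2.1, i, hi⟩

/-- From any vertex one can first travel inside the `τ`-EC to `Y`, without risk, and then use the
region of `Y`; so the union of both regions works. -/
theorem IsTauEC.conv {X : Proc 𝒜} {ec : LGraph 𝒜} (h : IsTauEC X ec) {E : Setoid (Proc 𝒜)}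
    (hE : ∀ Y ∈ ec.V, ∀ Z ∈ ec.V, E Y Z) {Y Z : Proc 𝒜} (hY : Y ∈ ec.V) (hZ : Z ∈ ec.V)
    {S : Set (Proc 𝒜)} (hc : Conv E Y S) : Conv E Z S := by
  obtain ⟨W, hYW, hWE, hW⟩ := hc
  refine ⟨W ∪ ec.V, Or.inr hZ, ?_, ?_⟩
  · rintro U (hU | hU)
    · exact E.trans (hE Z hZ Y hY) (hWE U hU)
    · exact hE Z hZ U hU
  · have hfromW : ∀ U ∈ W, ∃ L ∈ S, Relation.ReflTransGen (SafeStep (W ∪ ec.V)) U L := by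
      intro U hU
      obtain ⟨L, hL, hUL⟩ := hW U hU
      exact ⟨L, hL, Relation.ReflTransGen.mono
        (fun _ _ h => h.mono Set.subset_union_left) _ _ hUL⟩
    rintro U (hU | hU)
    · exact hfromW U hU
    · obtain ⟨L, hL, hYL⟩ := hfromW Y hYW
      exact ⟨L, hL, Relation.ReflTransGen.trans (Relation.ReflTransGen.mono
        (fun _ _ h => h.mono Set.subset_union_right) _ _ (h.reflTransGen_safeStep hU hY)) hYL⟩

theorem IsTauEC.trivialPartition_le_stepSetoid {X : Proc 𝒜} {ec : LGraph 𝒜} (h : IsTauEC X ec)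
    {E : Setoid (Proc 𝒜)} (hle : trivialPartition ec.V ≤ E) :
    trivialPartition ec.V ≤ stepSetoid E := by
  have hE : ∀ Y ∈ ec.V, ∀ Z ∈ ec.V, E Y Z := fun Y hY Z hZ => hle (Or.inr ⟨hY, hZ⟩)
  refine le_stepSetoid hle fun A B hAB => ?_
  rcases hAB with rfl | ⟨hA, hB⟩
  · exact ⟨fun _ _ => id, fun _ _ => id⟩
  have hmk : Quotient.mk E A = Quotient.mk E B := Quotient.eq.2 (hE A hA B hB)
  refine ⟨fun l C ht => ?_, fun q C ht => ?_⟩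
  · rw [lTrans_iff] at ht ⊢
    exact ⟨hmk ▸ ht.1, h.conv hE hA hB ht.2⟩
  · rw [qTrans_iff] at ht ⊢
    exact ⟨hmk ▸ ht.1, h.conv hE hA hB ht.2⟩

/-- Every `τ`-end component of a process in `R` lies inside a class of `E`. -/
def ECClosed (R : Set (Proc 𝒜)) (E : Setoid (Proc 𝒜)) : Prop :=
  ∀ X ∈ R, ∀ ec, IsTauEC X ec → ∀ Y ∈ ec.V, ∀ Z ∈ ec.V, E Y Z

/-- The join of `E` with the identification of the vertices is still a branching bisimulation below
`Eini`, so maximality puts it below `E`. -/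
theorem ECClosed.quotient {R : Set (Proc 𝒜)} {Eini E : Setoid (Proc 𝒜)} (h : ECClosed R Eini)
    (hE : IsQuotient Eini E) : ECClosed R E := by
  intro X hX ec hec Y hY Z hZ
  have hbb : IsBranchingBisim (E ⊔ trivialPartition ec.V) := isBranchingBisim_of_le
    (sup_le (hE.1.1.le_stepSetoid le_sup_left) (hec.trivialPartition_le_stepSetoid le_sup_right))
  have hle : E ⊔ trivialPartition ec.V ≤ Eini := by
    refine sup_le hE.1.2 fun A B hAB => ?_
    rcases hAB with rfl | ⟨hA, hB⟩
    · exact Eini.refl A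
    · exact h X hX ec hec A hA B hB
  exact hE.2 ⟨hbb, hle⟩ ((le_sup_right : trivialPartition ec.V ≤ _) (Or.inr ⟨hY, hZ⟩))

/-! ### Restriction to a set of processes that is closed under transitions -/

theorem inf_trivialPartition_iff {F : Setoid (Proc 𝒜)} {R : Set (Proc 𝒜)} {X Y : Proc 𝒜}
    (hX : X ∈ R) (hY : Y ∈ R) : (F ⊓ trivialPartition R) X Y ↔ F X Y :=
  ⟨fun h => h.1, fun h => ⟨h, Or.inr ⟨hX, hY⟩⟩⟩

theorem Conv.inf_trivialPartition {F : Setoid (Proc 𝒜)} {R : Set (Proc 𝒜)}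
    (hR : ∀ X ∈ R, ∀ l Y, X.Trans l Y → Y ∈ R) {A : Proc 𝒜} (hA : A ∈ R) {S : Set (Proc 𝒜)}
    (h : Conv F A S) : Conv (F ⊓ trivialPartition R) A (S ∩ R) := by
  obtain ⟨W, hWR, hAW, hWE, hW⟩ := h.restrict hR hA
  refine ⟨W, hAW, fun X hX => (inf_trivialPartition_iff hA (hWR hX)).2 (hWE X hX),
    fun X hX => ?_⟩
  obtain ⟨L, hL, hXL⟩ := hW X hX
  exact ⟨L, ⟨hL, hWR (mem_of_reflTransGen_safeStep hX hXL)⟩, hXL⟩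

theorem Conv.of_le {F E : Setoid (Proc 𝒜)} (hle : F ≤ E) {A : Proc 𝒜} {S : Set (Proc 𝒜)}
    (h : Conv F A S) : Conv E A S := by
  obtain ⟨W, hA, hWE, hW⟩ := h
  exact ⟨W, hA, fun X hX => hle (hWE X hX), hW⟩

theorem Conv.nonempty {E : Setoid (Proc 𝒜)} {A : Proc 𝒜} {S : Set (Proc 𝒜)}
    (h : Conv E A S) : ∃ L ∈ S, E A L := by
  obtain ⟨W, hA, hWE, hW⟩ := h
  obtain ⟨L, hL, hAL⟩ := hW A hA
  exact ⟨L, hL, hWE L (mem_of_reflTransGen_safeStep hA hAL)⟩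

/-- Witnesses of `≃ₑ` live on all processes, the partitions of the algorithm only on `R`. Closure of
`R` under transitions makes every target of a process of `R` visible in the restriction. -/
theorem IsBranchingBisim.inf_trivialPartition {F : Setoid (Proc 𝒜)} (hF : IsBranchingBisim F)
    {R : Set (Proc 𝒜)} (hR : ∀ X ∈ R, ∀ l Y, X.Trans l Y → Y ∈ R) :
    IsBranchingBisim (F ⊓ trivialPartition R) := by
  have hle : F ⊓ trivialPartition R ≤ F := inf_le_left
  intro A B hAB
  obtain ⟨hFAB, rfl | ⟨hA, hB⟩⟩ := id hAB
  · exact ⟨fun _ _ => id, fun _ _ => id⟩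
  have hmk : Quotient.mk (F ⊓ trivialPartition R) A = Quotient.mk (F ⊓ trivialPartition R) B :=
    Quotient.eq.2 hAB
  have hinf : ∀ {X Y}, X ∈ R → Y ∈ R → ((F ⊓ trivialPartition R) X Y ↔ F X Y) :=
    inf_trivialPartition_iff
  set F' := F ⊓ trivialPartition R with hF'
  have hback : ∀ {S : Set (Proc 𝒜)}, Conv F' A S → Conv F' A (S ∩ R) := by
    rintro S ⟨W, hAW, hWE, hW⟩
    exact Conv.mono (fun L hAL hL => ⟨hL, by
      rcases hAL.2 with rfl | h
      exacts [hA, h.2]⟩) ⟨W, hAW, hWE, hW⟩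
  refine ⟨fun l C h => ?_, fun q C h => ?_⟩
  · rw [lTrans_iff] at h ⊢
    refine ⟨hmk ▸ h.1, ?_⟩
    obtain ⟨L, ⟨⟨L', hLL', rfl⟩, hLR⟩, _⟩ := (hback h.2).nonempty
    have hL'R : L' ∈ R := hR L hLR _ _ hLL'
    have hl : LTrans F A l (Quotient.mk F L') := by
      refine lTrans_iff.2 ⟨h.1.imp_right fun h' => ⟨h'.1, fun he => h'.2 ?_⟩,
        (h.2.of_le hle).mono ?_⟩
      · rintro M _ ⟨M', hM, hM'⟩
        exact ⟨M', hM, Quotient.eq.2 (hle (Quotient.eq.1 hM'))⟩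
      · exact Quotient.eq.2 ((hinf hL'R hA).2 (Quotient.eq.1 he))
    refine ((lTrans_iff.1 ((hF A B hFAB).1 _ _ hl)).2.inf_trivialPartition hR hB).mono ?_
    rintro M _ ⟨⟨M', hM, hM'⟩, hMR⟩
    exact ⟨M', hM, Quotient.eq.2 ((hinf (hR M hMR _ _ hM) hL'R).2 (Quotient.eq.1 hM'))⟩
  · induction C using Quotient.inductionOn with | h Z => ?_
    rw [qTrans_iff] at h ⊢
    refine ⟨hmk ▸ h.1, ?_⟩
    by_cases hZ : Z ∈ R
    · have hiff : ∀ L ∈ R, L ∈ probSet F' q (Quotient.mk F' Z) ↔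
          L ∈ probSet F q (Quotient.mk F Z) := by
        intro L hL
        rw [mem_probSet_iff, mem_probSet_iff]
        refine exists_congr fun k => exists_congr fun p => exists_congr fun Q =>
          and_congr_right fun hc => ?_
        have hQ : ∀ i, Q i ∈ R := fun i => hR L hL _ _ (hc.trans i)
        rw [mass_congr (g := fun Y => F' Y Z) (g' := fun Y => F Y Z) fun i => hinf (hQ i) hZ,
          mass_congr (g := fun Y => ¬ F' Y L) (g' := fun Y => ¬ F Y L)
            fun i => not_congr (hinf (hQ i) hL)]
        simp only [hinf (hQ _) hL]
      have hq : QTrans F A q (Quotient.mk F Z) := by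
        refine qTrans_iff.2 ⟨fun he => h.1 ?_, ((hback h.2).of_le hle).mono ?_⟩
        · exact Quotient.eq.2 ((hinf hZ hA).2 (Quotient.eq.1 he))
        · exact fun L _ hL => (hiff L hL.2).1 hL.1
      refine ((qTrans_iff.1 ((hF A B hFAB).2 _ _ hq)).2.inf_trivialPartition hR hB).mono ?_
      exact fun L _ hL => (hiff L hL.2).2 hL.1
    -- A class outside `R` is never hit, so here `q = 0`. Such a transition still asserts that the
    -- class of `A` can be left, and `conv_leave` transfers this to `B`.
    · obtain ⟨L, ⟨hL, hLR⟩, hAL⟩ := (hback h.2).nonempty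
      have hzero : ∀ M ∈ R, ∀ {k : ℕ} {p : Fin k → ℝ} {Q : Fin k → Proc 𝒜}, M.Coll k p Q →
          mass p Q (fun Y => F' Y Z) = 0 := by
        intro M hM k p Q hc
        refine mass_eq_zero fun i hi => ?_
        have hQ := hR M hM _ _ (hc.trans i)
        rcases hi.2 with he | he
        · exact hZ (he ▸ hQ)
        · exact hZ he.2
      obtain ⟨k, p, Q, hc, ⟨j, hj⟩, rfl⟩ := mem_probSet_iff.1 hL
      have hj' : ¬ F (Q j) L := fun h => hj ((hinf (hR L hLR _ _ (hc.trans j)) hLR).2 h)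
      have hLB : F L B := F.trans (F.symm (hle hAL)) hFAB
      refine ((hF.conv_leave hLB hc ⟨j, hj'⟩).inf_trivialPartition hR hB).mono ?_
      rintro M hBM ⟨⟨k', p', Q', hc', ⟨j', hj'⟩, _⟩, hMR⟩
      refine mem_probSet_iff.2 ⟨k', p', Q', hc', ⟨j', fun h => hj' ?_⟩, ?_⟩
      · exact F.trans (hle h) (F.symm (F.trans hLB (hle hBM)))
      · rw [hzero L hLR hc, hzero M hMR hc']
        simp

/-! ### The procedure `CompMec` -/

theorem finite_tauGraph_edges (P : Proc 𝒜) : (tauGraph P).E.Finite := by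
  refine ((finite_reach P).biUnion fun X _ => (X.finite_trans).image (Prod.mk X)).subset ?_
  rintro ⟨X, l, Y⟩ ⟨hX, _, ht⟩
  exact Set.mem_biUnion hX.reach ⟨(l, Y), ht, rfl⟩

theorem LGraph.tauReach_of_transGen {P : Proc 𝒜} {g : LGraph 𝒜} (hg : g.E ⊆ (tauGraph P).E)
    {X Y : Proc 𝒜} (h : Relation.TransGen g.Adj X Y) : TauReach P X := by
  obtain ⟨Z, ⟨l, hl⟩, _⟩ := Relation.TransGen.head'_iff.1 h
  exact (hg hl).1

/-- Absence of bad edges is the closure condition `coll`; the rest is strong connectivity, with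
paths between vertices of the component never leaving it. -/
theorem LGraph.sccOf_isTauEC {P X : Proc 𝒜} {g : LGraph 𝒜} (hg : g.E ⊆ (tauGraph P).E)
    (hX : Relation.TransGen g.Adj X X) (hbad : ∀ e, ¬ (g.sccOf X).BadEdge e) :
    IsTauEC P (g.sccOf X) where
  nonempty := ⟨X, hX, hX⟩
  subset_reach Y hY := (tauReach_of_transGen hg hY.2).reach
  edge Y l Z h := ⟨h.2.1, h.2.2, (hg h.1).2.2⟩
  connected Y hY Z hZ := by
    have h : Relation.TransGen g.Adj Y Z := hY.2.trans hZ.1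
    induction h using Relation.TransGen.head_induction_on with
    | single h => obtain ⟨l, hl⟩ := h; exact Relation.TransGen.single ⟨l, hl, hY, hZ⟩
    | @head Y V h h' ih =>
      have hV : V ∈ (g.sccOf X).V := ⟨hY.1.tail h, h'.trans hZ.2⟩
      obtain ⟨l, hl⟩ := h
      exact Relation.TransGen.head ⟨l, hl, hY, hV⟩ (ih hV)
  silent Y l Z h := (hg h.1).2.1
  coll Y q Z h := by
    obtain ⟨k, p, Q, hc, hi⟩ := Proc.Trans.exists_coll (hg h.1).2.2
    refine ⟨k, p, Q, hc, hi, fun j => ?_⟩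
    by_contra hj
    exact hbad _ ⟨h, ⟨q, rfl⟩, p j, Q j, hc.trans j, hj⟩

/-- Inclusion of graphs. -/
def LGraph.Sub (g h : LGraph 𝒜) : Prop :=
  g.V ⊆ h.V ∧ g.E ⊆ h.E

theorem IsTauEC.sub_sccOf {B X : Proc 𝒜} {ec g : LGraph 𝒜} (h : IsTauEC B ec) (hg : ec.Sub g)
    (hX : X ∈ ec.V) : ec.Sub (g.sccOf X) := by
  have hconn : ∀ Y ∈ ec.V, ∀ Z ∈ ec.V, Relation.TransGen g.Adj Y Z := fun Y hY Z hZ =>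
    Relation.TransGen.mono (fun _ _ ⟨l, hl⟩ => ⟨l, hg.2 hl⟩) _ _ (h.connected Y hY Z hZ)
  have hV : ec.V ⊆ (g.sccOf X).V := fun Y hY => ⟨hconn X hX Y hY, hconn Y hY X hX⟩
  refine ⟨hV, fun e he => ?_⟩
  obtain ⟨h1, h2, _⟩ := h.edge e.1 e.2.1 e.2.2 he
  exact ⟨hg.2 he, hV h1, hV h2⟩

/-- A `τ`-EC with one probabilistic edge at a vertex contains the whole collective transition there,
which is unique. So no edge of it is bad in a graph containing it. -/
theorem IsTauEC.sub_prune {B : Proc 𝒜} {ec g : LGraph 𝒜} (h : IsTauEC B ec) (hg : ec.Sub g) :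
    ec.Sub g.prune := by
  refine ⟨hg.1, ?_⟩
  rintro ⟨X, l, Y⟩ he
  refine ⟨hg.2 he, ?_⟩
  rintro ⟨_, ⟨q, hq⟩, q', D, ht, hD⟩
  change l = Label.prob q at hq
  subst hq
  obtain ⟨k, p, Q, hc, _, hQ⟩ := h.coll X q Y he
  obtain ⟨k', p', Q', hc', j, hpj, hQj⟩ := Proc.Trans.exists_coll ht
  obtain ⟨rfl, h'⟩ := Sigma.mk.inj (hc.unique hc')
  obtain ⟨rfl, rfl⟩ := Prod.mk.inj (eq_of_heq h')
  refine hD (hg.2 ?_)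
  rw [← hpj, ← hQj]
  exact hQ j

/-- The state of `CompMec(P)` after `n` rounds. -/
def mecState (P : Proc 𝒜) (n : ℕ) : Set (LGraph 𝒜) × Set (LGraph 𝒜) :=
  compMecRound^[n] (∅, {tauGraph P})

theorem mecState_succ (P : Proc 𝒜) (n : ℕ) :
    mecState P (n + 1) = compMecRound (mecState P n) :=
  Function.iterate_succ_apply' _ _ _

/-- Each pruning deletes at least one edge, so every round costs an undecided graph an edge; this
bounds the number of rounds. -/
theorem mecState_undecided (P : Proc 𝒜) (n : ℕ) :
    ∀ g ∈ (mecState P n).2, g.E ⊆ (tauGraph P).E ∧ g.E.ncard + n ≤ (tauGraph P).E.ncard := by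
  induction n with
  | zero =>
    rintro g rfl
    exact ⟨subset_rfl, le_rfl⟩
  | succ n ih =>
    rw [mecState_succ]
    rintro _ ⟨g, hg, h, ⟨X, _, _, rfl⟩, ⟨e, he⟩, rfl⟩
    obtain ⟨h1, h2⟩ := ih g hg
    have hsub : (g.sccOf X).prune.E ⊆ g.E := fun e he => he.1.1
    have hlt : (g.sccOf X).prune.E.ncard < g.E.ncard :=
      Set.ncard_lt_ncard (hsub.ssubset_of_mem_notMem he.1.1 fun h => h.2 he)
        ((finite_tauGraph_edges P).subset h1)
    exact ⟨hsub.trans h1, by omega⟩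

theorem exists_compMec (P : Proc 𝒜) : ∃ M, CompMec P M := by
  refine ⟨_, (tauGraph P).E.ncard + 1, ?_, rfl⟩
  refine Set.eq_empty_iff_forall_notMem.2 fun g hg => ?_
  have := (mecState_undecided P _ g hg).2
  omega

theorem mecState_recorded (P : Proc 𝒜) (n : ℕ) : ∀ h ∈ (mecState P n).1, IsTauEC P h := by
  induction n with
  | zero => exact fun _ h => h.elim
  | succ n ih =>
    rw [mecState_succ]
    rintro h (hh | ⟨g, hg, ⟨X, _, hX, rfl⟩, hbad⟩)
    · exact ih h hh
    · exact LGraph.sccOf_isTauEC (mecState_undecided P n g hg).1 hX hbad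

theorem TauReach.of_transGen {B : Proc 𝒜} {ec : LGraph 𝒜} (h : IsTauEC B ec) {X Y : Proc 𝒜}
    (hXY : Relation.TransGen ec.Adj X Y) : TauReach X Y :=
  Relation.ReflTransGen.mono
    (fun _ _ ⟨l, hl⟩ => ⟨l, h.silent _ _ _ hl, (h.edge _ _ _ hl).2.2⟩) _ _ hXY.to_reflTransGen

theorem ReachesEC.tauReach {A B : Proc 𝒜} {ec : LGraph 𝒜} (hr : ReachesEC A ec)
    (h : IsTauEC B ec) {X : Proc 𝒜} (hX : X ∈ ec.V) : TauReach A X := by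
  obtain ⟨Y, hY, hAY⟩ := hr
  exact Relation.ReflTransGen.trans hAY (TauReach.of_transGen h (h.connected Y hY X hX))

/-- Neither decomposition nor pruning tears a `τ`-EC apart. Once no graph is undecided, the graph
that contains it has been recorded. -/
theorem mecState_sub {P : Proc 𝒜} {ec : LGraph 𝒜} (h : IsTauEC P ec) (hr : ReachesEC P ec)
    (n : ℕ) : ∃ g ∈ (mecState P n).1 ∪ (mecState P n).2, ec.Sub g := by
  induction n with
  | zero =>
    refine ⟨tauGraph P, Or.inr rfl, fun X hX => hr.tauReach h hX, ?_⟩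
    rintro ⟨X, l, Y⟩ he
    exact ⟨hr.tauReach h (h.edge _ _ _ he).1, h.silent _ _ _ he, (h.edge _ _ _ he).2.2⟩
  | succ n ih =>
    rw [mecState_succ]
    obtain ⟨g, hg | hg, hsub⟩ := ih
    · exact ⟨g, Or.inl (Or.inl hg), hsub⟩
    · obtain ⟨X, hX⟩ := h.nonempty
      have hsub' := h.sub_sccOf hsub hX
      have hscc : g.sccOf X ∈ g.sccs := ⟨X, hsub.1 hX, (hsub'.1 hX).1, rfl⟩
      by_cases hbad : ∃ e, (g.sccOf X).BadEdge e
      · exact ⟨_, Or.inr ⟨g, hg, _, hscc, hbad, rfl⟩, h.sub_prune hsub'⟩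
      · exact ⟨_, Or.inl (Or.inr ⟨g, hg, hscc, not_exists.1 hbad⟩), hsub'⟩

theorem CompMec.isTauEC {P : Proc 𝒜} {M : Set (LGraph 𝒜)} (hM : CompMec P M) {mec : LGraph 𝒜}
    (h : mec ∈ M) : IsTauEC P mec := by
  obtain ⟨n, _, rfl⟩ := hM
  exact mecState_recorded P n mec h

theorem CompMec.exists_sub {P : Proc 𝒜} {M : Set (LGraph 𝒜)} (hM : CompMec P M) {ec : LGraph 𝒜}
    (h : IsTauEC P ec) (hr : ReachesEC P ec) : ∃ mec ∈ M, ec.Sub mec := by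
  obtain ⟨n, h0, rfl⟩ := hM
  obtain ⟨g, hg | hg, hsub⟩ := mecState_sub h hr n
  · exact ⟨g, hg, hsub⟩
  · change g ∈ (compMecRound^[n] (∅, {tauGraph P})).2 at hg
    rw [h0] at hg
    exact hg.elim

theorem IsTauEC.of_reachesEC {X Z : Proc 𝒜} {ec : LGraph 𝒜} (h : IsTauEC X ec)
    (hr : ReachesEC Z ec) : IsTauEC Z ec :=
  { h with subset_reach := fun _ hY => (hr.tauReach h hY).reach }

theorem ReachesEC.sub {A : Proc 𝒜} {ec g : LGraph 𝒜} (hr : ReachesEC A ec) (h : ec.Sub g) :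
    ReachesEC A g := by
  obtain ⟨Y, hY, hAY⟩ := hr
  exact ⟨Y, h.1 hY, hAY⟩

/-! ### Splitting by maximal `τ`-end components -/

section

variable {R : Set (Proc 𝒜)} {E : Setoid (Proc 𝒜)}

/-- If `τ`-end components lie inside classes, then `CompMec` detects all related ones. -/
theorem ECClosed.reachesRelated_iff (hE : ECClosed R E) {Y : Proc 𝒜} (hY : Y ∈ R)
    {M : Set (LGraph 𝒜)} (hM : CompMec Y M) {mec : LGraph 𝒜} :
    ReachesRelated E mec M Y ↔
      ∃ ec, IsTauEC Y ec ∧ ReachesEC Y ec ∧ RelatedEC (fun X Y => E X Y) mec ec := by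
  constructor
  · rintro ⟨mec', hmem, hr, hrel⟩
    exact ⟨mec', hM.isTauEC hmem, hr, hrel⟩
  · rintro ⟨ec, hec, hr, hrel⟩
    obtain ⟨mec', hmem, hsub⟩ := hM.exists_sub hec hr
    refine ⟨mec', hmem, hr.sub hsub, fun Z hZ => ?_⟩
    -- All vertices of `mec'` lie in one class of `E`, so a partner for the single vertex `Z₀`
    -- serves them all.
    obtain ⟨Z₀, hZ₀⟩ := hec.nonempty
    obtain ⟨X, hX, hXZ⟩ := hrel Z₀ hZ₀
    exact ⟨X, hX, E.trans hXZ (hE Y hY _ (hM.isTauEC hmem) _ (hsub.1 hZ₀) _ hZ)⟩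

/-- Vertices of a `τ`-EC reach each other silently and hence silently reach the same `τ`-ECs, so the
splitting test cannot tell them apart. -/
theorem ECClosed.mecRefine (hE : ECClosed R E) (hR : ∀ X ∈ R, Reach X ⊆ R)
    {MEC : Proc 𝒜 → Set (LGraph 𝒜)} (hMEC : ∀ X ∈ R, CompMec X (MEC X)) (P : Proc 𝒜)
    (mec : LGraph 𝒜) : ECClosed R (mecRefine MEC E P mec) := by
  intro X hX ec hec
  have key : ∀ Y ∈ ec.V, ∀ Z ∈ ec.V, ReachesRelated E mec (MEC Y) Y →
      ReachesRelated E mec (MEC Z) Z := by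
    intro Y hY Z hZ
    have hYR := hR X hX (hec.subset_reach hY)
    have hZR := hR X hX (hec.subset_reach hZ)
    rw [hE.reachesRelated_iff hYR (hMEC Y hYR), hE.reachesRelated_iff hZR (hMEC Z hZR)]
    rintro ⟨ec', hec', ⟨V, hV, hYV⟩, hrel⟩
    have hr : ReachesEC Z ec' :=
      ⟨V, hV, Relation.ReflTransGen.trans (TauReach.of_transGen hec (hec.connected Z hZ Y hY)) hYV⟩
    exact ⟨ec', hec'.of_reachesEC hr, hr, hrel⟩
  exact fun Y hY Z hZ => ⟨hE X hX ec hec Y hY Z hZ, fun _ => ⟨key Y hY Z hZ, key Z hZ Y hY⟩⟩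

/-- Restrictions of exhaustive branching bisimulations survive the splitting of a class. -/
theorem IsExhaustiveBranchingBisim.le_mecRefine {F : Setoid (Proc 𝒜)}
    (hF : IsExhaustiveBranchingBisim F) (hle : F ⊓ trivialPartition R ≤ E) (hE : ECClosed R E)
    (hR : ∀ X ∈ R, Reach X ⊆ R) {MEC : Proc 𝒜 → Set (LGraph 𝒜)}
    (hMEC : ∀ X ∈ R, CompMec X (MEC X)) (P : Proc 𝒜) (mec : LGraph 𝒜) :
    F ⊓ trivialPartition R ≤ mecRefine MEC E P mec := by
  have key : ∀ X ∈ R, ∀ Y ∈ R, F X Y → ReachesRelated E mec (MEC X) X →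
      ReachesRelated E mec (MEC Y) Y := by
    intro X hX Y hY hXY
    rw [hE.reachesRelated_iff hX (hMEC X hX), hE.reachesRelated_iff hY (hMEC Y hY)]
    rintro ⟨ec, hec, hr, hrel⟩
    -- `F` answers `ec` by `ec'`, whose vertices are `F`-related to vertices of `ec`. Both graphs
    -- lie in `R`, so this relation passes to `E` and composes with `hrel`.
    obtain ⟨ec', hec', hr', hrel'⟩ := (hF.2 X Y hXY).1 ec hec hr
    refine ⟨ec', hec', hr', fun Z hZ => ?_⟩
    obtain ⟨U, hU, hUZ⟩ := hrel' Z hZ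
    obtain ⟨V, hV, hVU⟩ := hrel U hU
    exact ⟨V, hV, E.trans hVU (hle ⟨hUZ, Or.inr ⟨hR X hX (hec.subset_reach hU),
      hR Y hY (hec'.subset_reach hZ)⟩⟩)⟩
  intro X Y hXY
  refine ⟨hle hXY, fun _ => ?_⟩
  obtain ⟨hXY', rfl | ⟨hX, hY⟩⟩ := hXY
  · exact Iff.rfl
  · exact ⟨key X hX Y hY hXY', key Y hY X hX (F.symm hXY')⟩

/-- Without mec splitters, a branching bisimulation is exhaustive. -/
theorem tauECInvariant_of_no_splitter (hE : ECClosed R E) (hER : E ≤ trivialPartition R)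
    {MEC : Proc 𝒜 → Set (LGraph 𝒜)} (hMEC : ∀ X ∈ R, CompMec X (MEC X))
    (h : ∀ P mec, ¬ IsMecSplitter R MEC E P mec) : TauECInvariant (fun X Y => E X Y) := by
  have key : ∀ X Y, E X Y → ∀ ec₁, IsTauEC X ec₁ → ReachesEC X ec₁ →
      ∃ ec₂, IsTauEC Y ec₂ ∧ ReachesEC Y ec₂ ∧ RelatedEC (fun X Y => E X Y) ec₁ ec₂ := by
    intro X Y hXY ec hec hr
    rcases hER hXY with rfl | ⟨hX, hY⟩
    · exact ⟨ec, hec, hr, fun Z hZ => ⟨Z, hZ, E.refl Z⟩⟩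
    obtain ⟨mec, hmem, hsub⟩ := (hMEC X hX).exists_sub hec hr
    have hrel : ReachesRelated E mec (MEC Y) Y := by
      by_contra hn
      exact h X mec ⟨Y, hX, hY, hXY, hmem, hr.sub hsub, hn⟩
    obtain ⟨mec', hmem', hr', hrel'⟩ := hrel
    refine ⟨mec', (hMEC Y hY).isTauEC hmem', hr', fun Z hZ => ?_⟩
    obtain ⟨V, hV, hVZ⟩ := hrel' Z hZ
    -- The given `τ`-EC may be smaller than `mec`, but as `mec` lies in one class, any vertex of it
    -- can replace `V`.
    obtain ⟨U, hU⟩ := hec.nonempty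
    exact ⟨U, hU, E.trans (hE X hX _ ((hMEC X hX).isTauEC hmem) U (hsub.1 hU) V hV) hVZ⟩
  refine fun X Y hXY => ⟨key X Y hXY, fun ec₂ hec hr => ?_⟩
  obtain ⟨ec₁, h1, h2, h3⟩ := key Y X (E.symm hXY) ec₂ hec hr
  refine ⟨ec₁, h1, h2, fun Z hZ => ?_⟩
  obtain ⟨U, hU, hUZ⟩ := h3 Z hZ
  exact ⟨U, hU, E.symm hUZ⟩

end

/-! ### The algorithm `ExhBranBisim` -/

theorem reach_subset_reachSet (A B : Proc 𝒜) : ∀ X ∈ reachSet A B, Reach X ⊆ reachSet A B := by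
  rintro X (hX | hX) Y hY
  · exact Or.inl (Reach.trans hX hY)
  · exact Or.inr (Reach.trans hX hY)

theorem reachSet_trans (A B : Proc 𝒜) :
    ∀ X ∈ reachSet A B, ∀ l Y, X.Trans l Y → Y ∈ reachSet A B :=
  fun X hX _ _ h => reach_subset_reachSet A B X hX (Reach.tail (Reach.refl X) h)

/-- The loop invariant for the current `Eini`. -/
structure LoopInvariant (A B : Proc 𝒜) (Eini : Setoid (Proc 𝒜)) : Prop where
  ecClosed : ECClosed (reachSet A B) Eini
  le : Eini ≤ trivialPartition (reachSet A B)
  exhaustive_le : ∀ F, IsExhaustiveBranchingBisim F → F ⊓ trivialPartition (reachSet A B) ≤ Eini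

theorem LoopInvariant.init (A B : Proc 𝒜) :
    LoopInvariant A B (trivialPartition (reachSet A B)) where
  ecClosed X hX _ hec _ hY _ hZ :=
    Or.inr ⟨reach_subset_reachSet A B X hX (hec.subset_reach hY),
      reach_subset_reachSet A B X hX (hec.subset_reach hZ)⟩
  le := le_rfl
  exhaustive_le _ _ := inf_le_right

theorem LoopInvariant.quotient {A B : Proc 𝒜} {Eini E : Setoid (Proc 𝒜)}
    (h : LoopInvariant A B Eini) (hE : IsQuotient Eini E) : LoopInvariant A B E where
  ecClosed := h.ecClosed.quotient hE
  le := hE.1.2.trans h.le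
  exhaustive_le F hF :=
    hE.2 ⟨hF.1.inf_trivialPartition (reachSet_trans A B), h.exhaustive_le F hF⟩

theorem mecRefine_le (MEC : Proc 𝒜 → Set (LGraph 𝒜)) (E : Setoid (Proc 𝒜)) (P : Proc 𝒜)
    (mec : LGraph 𝒜) : mecRefine MEC E P mec ≤ E := fun _ _ h => h.1

theorem LoopInvariant.mecRefine {A B : Proc 𝒜} {E : Setoid (Proc 𝒜)} (h : LoopInvariant A B E)
    {MEC : Proc 𝒜 → Set (LGraph 𝒜)} (hMEC : ∀ X ∈ reachSet A B, CompMec X (MEC X))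
    (P : Proc 𝒜) (mec : LGraph 𝒜) : LoopInvariant A B (mecRefine MEC E P mec) where
  ecClosed := h.ecClosed.mecRefine (reach_subset_reachSet A B) hMEC P mec
  le := (mecRefine_le MEC E P mec).trans h.le
  exhaustive_le F hF :=
    hF.le_mecRefine (h.exhaustive_le F hF) h.ecClosed (reach_subset_reachSet A B) hMEC P mec

/-- When no splitter is left, `E` itself witnesses `≃ₑ`; conversely it contains the restriction of
any other witness, and `A` and `B` lie in `R`. -/
theorem LoopInvariant.rel_iff {A B : Proc 𝒜} {E : Setoid (Proc 𝒜)} (h : LoopInvariant A B E)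
    (hE : IsBranchingBisim E) {MEC : Proc 𝒜 → Set (LGraph 𝒜)}
    (hMEC : ∀ X ∈ reachSet A B, CompMec X (MEC X))
    (hn : ∀ P mec, ¬ IsMecSplitter (reachSet A B) MEC E P mec) : E A B ↔ ExhBisimilar A B := by
  constructor
  · exact fun hAB => ⟨E, ⟨hE, tauECInvariant_of_no_splitter h.ecClosed h.le hMEC hn⟩, hAB⟩
  · rintro ⟨F, hF, hAB⟩
    exact h.exhaustive_le F hF ⟨hAB, Or.inr ⟨Or.inl (Reach.refl A), Or.inr (Reach.refl B)⟩⟩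

/-- The invariant of configurations: the loop invariant, or correctness of the result. -/
def Config.Correct (A B : Proc 𝒜) : Config 𝒜 → Prop
  | loop Eini => LoopInvariant A B Eini
  | halt b => b = true ↔ ExhBisimilar A B

theorem Config.Correct.step {A B : Proc 𝒜} {c c' : Config 𝒜} (h : c.Correct A B)
    (hs : AlgStep A B c c') : c'.Correct A B := by
  cases hs with
  | refine Eini E MEC P mec hE hMEC _ =>
    exact (LoopInvariant.quotient h hE).mecRefine hMEC P mec
  | finish Eini E MEC b hE hMEC hfind hb =>
    cases hfind with
    | notFound hn => exact hb.trans ((LoopInvariant.quotient h hE).rel_iff hE.1.1 hMEC hn)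

theorem Config.correct_of_reachable {A B : Proc 𝒜} {c : Config 𝒜}
    (h : Relation.ReflTransGen (AlgStep A B) (initConfig A B) c) : c.Correct A B := by
  induction h with
  | refl => exact LoopInvariant.init A B
  | tail _ hs ih => exact ih.step hs

/-! ### Progress and termination of the loop -/

theorem exists_algStep (A B : Proc 𝒜) (Eini : Setoid (Proc 𝒜)) :
    ∃ c, AlgStep A B (Config.loop Eini) c := by
  classical
  obtain ⟨E, hE⟩ := exists_isQuotient Eini
  choose MEC hMEC using exists_compMec (𝒜 := 𝒜)
  by_cases h : ∃ P mec, IsMecSplitter (reachSet A B) MEC E P mec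
  · obtain ⟨P, mec, h⟩ := h
    exact ⟨_, AlgStep.refine Eini E MEC P mec hE (fun X _ => hMEC X) (FindMecSplit.found P mec h)⟩
  · simp only [not_exists] at h
    exact ⟨_, AlgStep.finish Eini E MEC (decide (E A B)) hE (fun X _ => hMEC X)
      (FindMecSplit.notFound h) (by simp)⟩

theorem neverStuck (A B : Proc 𝒜) : NeverStuck A B := by
  rintro (Eini | b) _
  · exact Or.inr (exists_algStep A B Eini)
  · exact Or.inl ⟨b, rfl⟩

theorem acc_halt (A B : Proc 𝒜) (b : Bool) :
    Acc (fun c' c => AlgStep A B c c') (Config.halt b) :=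
  ⟨_, fun _ h => nomatch h⟩

/-- The pairs of processes in `R` that are identified by `E`. -/
def relPairs (R : Set (Proc 𝒜)) (E : Setoid (Proc 𝒜)) : Set (Proc 𝒜 × Proc 𝒜) :=
  {e | e.1 ∈ R ∧ e.2 ∈ R ∧ E e.1 e.2}

theorem ncard_relPairs_mecRefine_lt {R : Set (Proc 𝒜)} (hR : R.Finite)
    {MEC : Proc 𝒜 → Set (LGraph 𝒜)} {Eini E : Setoid (Proc 𝒜)} (hle : E ≤ Eini) {P : Proc 𝒜}
    {mec : LGraph 𝒜} (h : IsMecSplitter R MEC E P mec) :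
    (relPairs R (mecRefine MEC E P mec)).ncard < (relPairs R Eini).ncard := by
  obtain ⟨Q, hP, hQ, hPQ, hmec, hr, hn⟩ := h
  refine Set.ncard_lt_ncard (Set.ssubset_iff_of_subset ?_ |>.2 ⟨(P, Q), ?_, ?_⟩)
    ((hR.prod hR).subset fun e he => ⟨he.1, he.2.1⟩)
  · exact fun e he => ⟨he.1, he.2.1, hle he.2.2.1⟩
  · exact ⟨hP, hQ, hle hPQ⟩
  · rintro ⟨_, _, _, hiff⟩
    -- By reflexivity `P` passes the test against its own component, while `Q` fails it, so the pair
    -- `(P, Q)` is lost.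
    exact hn ((hiff (E.refl P)).1 ⟨mec, hmec, hr, fun Y hY => ⟨Y, hY, E.refl Y⟩⟩)

theorem terminates (A B : Proc 𝒜) : Terminates A B := by
  have hR : (reachSet A B).Finite := (finite_reach A).union (finite_reach B)
  have key : ∀ n, ∀ Eini : Setoid (Proc 𝒜), (relPairs (reachSet A B) Eini).ncard = n →
      Acc (fun c' c => AlgStep A B c c') (Config.loop Eini) := by
    intro n
    induction n using Nat.strong_induction_on with
    | _ n ih =>
      rintro Eini rfl
      refine ⟨_, fun c hs => ?_⟩
      cases hs with
      | refine _ E MEC P mec hE _ hfind =>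
        cases hfind with
        | found _ _ h => exact ih _ (ncard_relPairs_mecRefine_lt hR hE.1.2 h) _ rfl
      | finish => exact acc_halt A B _
  exact key _ _ rfl

theorem exists_returns (A B : Proc 𝒜) : ∃ b, Returns A B b := by
  have key : ∀ c, Acc (fun c' c => AlgStep A B c c') c →
      ∃ b, Relation.ReflTransGen (AlgStep A B) c (Config.halt b) := by
    intro c hc
    induction hc with
    | intro c _ ih =>
      cases c with
      | halt b => exact ⟨b, Relation.ReflTransGen.refl⟩
      | loop Eini =>
        obtain ⟨c', hs⟩ := exists_algStep A B Eini
        obtain ⟨b, hb⟩ := ih c' hs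
        exact ⟨b, hb.head hs⟩
  exact key _ (terminates A B)

end RCCS

/-- `ExhBranBisim(A, B)` always terminates with a result, and in every execution the result is true
if and only if `A ≃ₑ B`. -/
theorem theorem5p10 {𝒜 : Type*} (A B : RCCS.Proc 𝒜) :
    RCCS.Terminates A B ∧ RCCS.NeverStuck A B ∧
      (∃ b, RCCS.Returns A B b) ∧
      ∀ b, RCCS.Returns A B b → (b = true ↔ RCCS.ExhBisimilar A B) :=
  ⟨RCCS.terminates A B, RCCS.neverStuck A B, RCCS.exists_returns A B,
    fun _ hb => RCCS.Config.correct_of_reachable hb⟩
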